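/- Let $\alpha,\beta:[0,2\pi]\to\mathbb{R}^3$ and $\gamma:[0,\pi]\to\mathbb{R}^3$ be the curves $$\alpha(t)=(\cos t,\sin t,1),\qquad \beta(t)=(\cos t,\sin t,-1),\qquad \gamma(t)=\left(2\cos(2t)-1,\;2\sin(2t),\;\tfrac98\cos t-\tfrac18\cos(3t)\right),$$ let $C\subseteq\mathbb{R}^3$ be the convex hull of the union of (the images of) $\alpha$, $\beta$ and $\gamma$, and let $$\mathcal{K}=\operatorname{cone}(C\times\{1\})=\{\lambda (x,1) \mid x\in C,\ \lambda\ge 0\}\subseteq\mathbb{R}^4 .$$ A face of a closed convex cone $\mathcal{K}$ is a nonempty closed convex subset $\mathcal{F}\subseteq\mathcal{K}$ such that whenever $x,y\in\mathcal{K}$ and $\lambda x+(1-\lambda)y\in\mathcal{F}$ for some $\lambda\in(0,1)$, then $x,y\in\mathcal{F}$. The cone $\mathcal{K}$ is called nice if $\mathcal{F}^*=\mathcal{K}^*+\mathcal{F}^\perp$ for every face $\mathcal{F}$ of $\mathcal{K}$, where $S^*=\{y \mid \langle x,y\rangle\ge 0 \text{ for all } x\in S\}$ and $S^\perp=\{y\mid\langle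 x,y\rangle=0\text{ for all }x\in S\}$. It is called amenable if for every face $\mathcal{F}$ of $\mathcal{K}$ there is a constant $\kappa>0$ such that $\operatorname{dist}(x,\mathcal{F})\le\kappa\operatorname{dist}(x,\mathcal{K})$ for all $x\in\operatorname{span}\mathcal{F}$, where $\operatorname{dist}$ is the Euclidean distance. Theorem. The set $\mathcal{K}$ defined above is a closed convex cone that spans $\mathbb{R}^4$; it is nice, but it is not amenable. In particular, there exists a nice closed convex cone in $\mathbb{R}^4$ that is not amenable. -/

import Mathlib

open scoped Pointwise

noncomputable section

namespace NiceCone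

section General

variable {E : Type*} [NormedAddCommGroup E] [InnerProductSpace ℝ E]

/-- `F` is a (nonempty) face of the convex set `C`: a closed convex subset of `C` such that whenever
a point of an open segment with end points in `C` lies in `F`, both end points lie in `F`. -/
structure IsFace (F C : Set E) : Prop where
  nonempty : F.Nonempty
  isClosed : IsClosed F
  convex : Convex ℝ F
  extreme : IsExtreme ℝ C F

/-- The cone generated by `S`: all `l • x` with `x ∈ S` and `l ≥ 0`. -/
def coneGen (S : Set E) : Set E := {y | ∃ l : ℝ, 0 ≤ l ∧ ∃ x ∈ S, y = l • x}

/-- The dual cone `{y | ⟪x, y⟫ ≥ 0 for all x ∈ S}`, functionals being identified with vectors through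
the inner product. -/
def dualCone (S : Set E) : Set E := {y | ∀ x ∈ S, 0 ≤ inner ℝ x y}

/-- The orthogonal complement of a set. -/
def perp (S : Set E) : Set E := {y | ∀ x ∈ S, inner ℝ x y = 0}

/-- A cone is nice (facially dual complete) if `F^* = K^* + F^⊥` for all its faces `F`. -/
def IsNice (K : Set E) : Prop :=
  ∀ F : Set E, IsFace F K → dualCone F = dualCone K + perp F

/-- A cone `K` is amenable if for every face `F` there is `κ > 0` such that
`dist (x, F) ≤ κ * dist (x, K)` for all `x` in the linear span of `F`. -/
def IsAmenable (K : Set E) : Prop :=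
  ∀ F : Set E, IsFace F K → ∃ κ : ℝ, 0 < κ ∧
    ∀ x ∈ Submodule.span ℝ F, Metric.infDist x F ≤ κ * Metric.infDist x K

end General

/-- Unit circle at height `1`. -/
def α (t : ℝ) : EuclideanSpace ℝ (Fin 3) := !₂[Real.cos t, Real.sin t, 1]

/-- Unit circle at height `-1`. -/
def β (t : ℝ) : EuclideanSpace ℝ (Fin 3) := !₂[Real.cos t, Real.sin t, -1]

/-- The twisted trigonometric curve. -/
def γ (t : ℝ) : EuclideanSpace ℝ (Fin 3) :=
  !₂[2 * Real.cos (2 * t) - 1, 2 * Real.sin (2 * t),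
    9 / 8 * Real.cos t - 1 / 8 * Real.cos (3 * t)]

/-- The convex hull of the three curves. -/
def C : Set (EuclideanSpace ℝ (Fin 3)) :=
  convexHull ℝ (α '' Set.Icc 0 (2 * Real.pi) ∪ β '' Set.Icc 0 (2 * Real.pi) ∪
    γ '' Set.Icc 0 Real.pi)

/-- The embedding `x ↦ (x, 1)` of `ℝ³` into `ℝ⁴`. -/
def lift (x : EuclideanSpace ℝ (Fin 3)) : EuclideanSpace ℝ (Fin 4) := !₂[x 0, x 1, x 2, 1]

/-- The cone generated by `C × {1}`. -/
def K : Set (EuclideanSpace ℝ (Fin 4)) := coneGen (lift '' C)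

end NiceCone

end

/-!
The curve `γ` starts on the top circle at `(1, 0, 1)`, ends on the bottom circle at `(1, 0, -1)`,
and projects onto the circle of centre `(-1, 0)` and radius `2`, which encloses the unit circle and
touches it at `(1, 0)`. It leaves the top plane `z = 1` very slowly: the height difference
`1 - γ₂ t = (1 - cos t)² (2 + cos t) / 2` is of order `t ^ 4`, while the distance of `γ t` from the
vertical cylinder over the unit circle is of order `t ^ 2`. Pushing `γ t` up to height `1` therefore
gives points in the plane of the top disc which are much closer to `C` than to the disc, and `K` is
not amenable at the cone over the disc (`not_isAmenable_K`).

Niceness at a face `F` says that every functional nonnegative on `F` agrees on `F` with a functional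
nonnegative on `K` (`IsFace.exists_dual`). A face other than `K` lies in a supporting hyperplane
(`IsFace.exists_perp`), hence in the cone spanned by the generators on that hyperplane
(`mem_of_inner_eq_zero`). By the symmetry `(x, y, z) ↦ (x, -y, -z)` the hyperplane may be assumed
not to face downwards.

* If it is horizontal, `F` lies in the cone over the top disc. A ray is harmless, so the case that
  matters is that of the whole disc. There a supporting line of the disc has to be extended to a
  supporting plane of `C`. This is possible because the supporting line at `(1, 0)` also supports
  the big disc, and for the other lines a multiple of `1 - z` can be added
  (`exists_height_multiple`).
* If it is vertical and touches both circles, then it is the plane `x = 1`, and it touches the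
  generators in `(1, 0, 1)` and `(1, 0, -1)` only. In all other cases it misses the bottom circle,
  touches the top circle at most once, and touches `γ`, between its end points, at most once. The
  last fact is the main computation (`contactPoly_zero_unique`): in the variable `u = tan (t / 2)`
  the hyperplane becomes a sextic polynomial that is nonnegative for `u > 0`, and it cannot have two
  double zeros. So `F` lies in a cone spanned by two generators, each of which is separated from
  the other by an explicit supporting hyperplane (`IsFace.exists_dual_of_pair`).
-/

noncomputable section

namespace NiceCone

local notation "E4" => EuclideanSpace ℝ (Fin 4)

/-! ### The contact polynomial -/

/-- With `h t = 1 - γ₂ t`, the function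
`(e + a) - 2 * (a * cos (2 * t) + b * sin (2 * t)) + m * h t`, multiplied by `(1 + u ^ 2) ^ 3` and
written in the variable `u = tan (t / 2)`. Up to this positive factor it is the value at `γ t` of
the affine functional `(e + m) - a * x - b * y - m * z` (see `inner_γ_mul`), so that its positive
zeros are the points where the corresponding plane meets `γ`. -/
def contactPoly (a b m e u : ℝ) : ℝ :=
  (e - a) - 8 * b * u + (3 * e + 13 * a) * u ^ 2 + (3 * e + 13 * a + 6 * m) * u ^ 4 +
    8 * b * u ^ 5 + (e - a + 2 * m) * u ^ 6

/-- The derivative of `contactPoly` in `u`. -/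
def contactPolyDeriv (a b m e u : ℝ) : ℝ :=
  -(8 * b) + 2 * (3 * e + 13 * a) * u + 4 * (3 * e + 13 * a + 6 * m) * u ^ 3 +
    40 * b * u ^ 4 + 6 * (e - a + 2 * m) * u ^ 5

lemma hasDerivAt_contactPoly (a b m e u : ℝ) :
    HasDerivAt (contactPoly a b m e) (contactPolyDeriv a b m e u) u := by
  unfold contactPoly contactPolyDeriv
  have h1 := hasDerivAt_id' u
  have := (((((h1.const_mul (8 * b)).const_sub (e - a)).fun_add
    ((h1.fun_pow 2).const_mul (3 * e + 13 * a))).fun_add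
    ((h1.fun_pow 4).const_mul (3 * e + 13 * a + 6 * m))).fun_add
    ((h1.fun_pow 5).const_mul (8 * b))).fun_add ((h1.fun_pow 6).const_mul (e - a + 2 * m))
  refine this.congr_deriv ?_
  push_cast
  ring

/-- Contacts are tangential: zeros of a nonnegative function are critical points. -/
lemma contactPolyDeriv_eq_zero {a b m e u : ℝ} (hG : ∀ v, 0 < v → 0 ≤ contactPoly a b m e v)
    (hu : 0 < u) (h : contactPoly a b m e u = 0) : contactPolyDeriv a b m e u = 0 := by
  refine IsLocalMin.hasDerivAt_eq_zero ?_ (hasDerivAt_contactPoly a b m e u)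
  filter_upwards [lt_mem_nhds hu] with v hv
  rw [h]
  exact hG v hv

/-- Descartes' rule for one sign change: if `∑ Tⱼ * x ^ j` has one sign change and vanishes at
`x = 1`, then it does not vanish at any `r > 1`. -/
lemma false_of_one_sign_change {r T0 T2 T4 T5 T6 : ℝ} (hr : 1 < r) (h0 : T0 < 0)
    (h24 : 0 ≤ T2 → 0 ≤ T4) (h5 : 0 ≤ T5) (h6 : 0 < T6)
    (e1 : T0 + T2 + T4 + T5 + T6 = 0)
    (e2 : T0 + r ^ 2 * T2 + r ^ 4 * T4 + r ^ 5 * T5 + r ^ 6 * T6 = 0) : False := by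
  have a2 : 1 < r ^ 2 := one_lt_pow₀ hr (by norm_num)
  have a4 : r ^ 2 < r ^ 4 := pow_lt_pow_right₀ hr (by norm_num)
  have a5 : r ^ 4 < r ^ 5 := pow_lt_pow_right₀ hr (by norm_num)
  have a6 : r ^ 5 < r ^ 6 := pow_lt_pow_right₀ hr (by norm_num)
  rcases le_or_gt 0 T2 with h2 | h2
  · nlinarith [mul_nonneg (sub_nonneg.2 a2.le) h2,
      mul_nonneg (sub_nonneg.2 (a2.trans a4).le) (h24 h2),
      mul_nonneg (sub_nonneg.2 (a2.trans (a4.trans a5)).le) h5,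
      mul_pos (sub_pos.2 (a2.trans (a4.trans (a5.trans a6)))) h6]
  · rcases le_or_gt 0 T4 with h4 | h4
    · nlinarith [mul_pos_of_neg_of_neg (sub_neg.2 a2) h0, mul_nonneg (sub_nonneg.2 a4.le) h4,
        mul_nonneg (sub_nonneg.2 (a4.trans a5).le) h5,
        mul_pos (sub_pos.2 (a4.trans (a5.trans a6))) h6]
    · nlinarith [mul_pos_of_neg_of_neg (sub_neg.2 (a2.trans a4)) h0,
        mul_pos_of_neg_of_neg (sub_neg.2 a4) h2,
        mul_nonneg (sub_nonneg.2 a5.le) h5, mul_pos (sub_pos.2 (a5.trans a6)) h6]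

/-- At a double zero of `G = contactPoly a b m e` the polynomial `u * G' - G` vanishes. The linear
term of `G` drops out of it, which leaves a single sign change when `0 ≤ b`. -/
lemma contact_unique_of_nonneg_right {a b m e u v : ℝ} (hm : 0 ≤ m) (hb : 0 ≤ b) (hea : a < e)
    (hu : 0 < u) (huv : u < v) (h1 : contactPoly a b m e u = 0)
    (h1' : contactPolyDeriv a b m e u = 0)
    (h2 : contactPoly a b m e v = 0) (h2' : contactPolyDeriv a b m e v = 0) : False := by
  obtain ⟨r, hr, rfl⟩ : ∃ r, 1 < r ∧ v = r * u :=
    ⟨v / u, (one_lt_div hu).2 huv, by field_simp⟩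
  unfold contactPoly at h1 h2
  unfold contactPolyDeriv at h1' h2'
  refine false_of_one_sign_change (r := r) (T0 := a - e) (T2 := (3 * e + 13 * a) * u ^ 2)
    (T4 := 3 * (3 * e + 13 * a + 6 * m) * u ^ 4) (T5 := 32 * b * u ^ 5)
    (T6 := 5 * (e - a + 2 * m) * u ^ 6) hr (by linarith) (fun h => ?_) (by positivity) ?_ ?_ ?_
  · have : 0 ≤ 3 * e + 13 * a := nonneg_of_mul_nonneg_left h (by positivity)
    positivity
  · have : 0 < e - a + 2 * m := by linarith
    positivity
  · linear_combination u * h1' - h1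
  · linear_combination r * u * h2' - h2

/-- When `b < 0 ≤ a`, the combination with a single sign change is `u * G' - 5 * G`. -/
lemma contact_unique_of_neg_right {a b m e u v : ℝ} (hm : 0 ≤ m) (hb : b < 0) (ha : 0 ≤ a)
    (hea : a < e)
    (hu : 0 < u) (huv : u < v) (h1 : contactPoly a b m e u = 0)
    (h1' : contactPolyDeriv a b m e u = 0)
    (h2 : contactPoly a b m e v = 0) (h2' : contactPolyDeriv a b m e v = 0) : False := by
  obtain ⟨r, hr, rfl⟩ : ∃ r, 1 < r ∧ v = r * u :=
    ⟨v / u, (one_lt_div hu).2 huv, by field_simp⟩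
  unfold contactPoly at h1 h2
  unfold contactPolyDeriv at h1' h2'
  have e1 : 5 * (e - a) - 32 * b * u + 3 * (3 * e + 13 * a) * u ^ 2 +
      (3 * e + 13 * a + 6 * m) * u ^ 4 - (e - a + 2 * m) * u ^ 6 = 0 := by
    linear_combination 5 * h1 - u * h1'
  have e2 : 5 * (e - a) - 32 * b * (r * u) + 3 * (3 * e + 13 * a) * (r * u) ^ 2 +
      (3 * e + 13 * a + 6 * m) * (r * u) ^ 4 - (e - a + 2 * m) * (r * u) ^ 6 = 0 := by
    linear_combination 5 * h2 - r * u * h2'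
  have p0 : 0 < (r ^ 6 - 1) * (5 * (e - a)) :=
    mul_pos (sub_pos.2 (one_lt_pow₀ hr (by norm_num))) (by linarith)
  have p1 : 0 ≤ (r ^ 6 - r ^ 1) * (32 * -b * u) :=
    mul_nonneg (sub_nonneg.2 (pow_le_pow_right₀ hr.le (by norm_num)))
      (mul_nonneg (by linarith) hu.le)
  have p2 : 0 ≤ (r ^ 6 - r ^ 2) * (3 * (3 * e + 13 * a) * u ^ 2) :=
    mul_nonneg (sub_nonneg.2 (pow_le_pow_right₀ hr.le (by norm_num)))
      (mul_nonneg (by linarith) (by positivity))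
  have p4 : 0 ≤ (r ^ 6 - r ^ 4) * ((3 * e + 13 * a + 6 * m) * u ^ 4) :=
    mul_nonneg (sub_nonneg.2 (pow_le_pow_right₀ hr.le (by norm_num)))
      (mul_nonneg (by linarith) (by positivity))
  nlinarith

/-- The numerator of minus the derivative of
`4 * A * (u⁻² - u²) - B * (u⁻³ - 5 * u⁻¹ - 5 * u + u³)`, the function which takes the value `3 * m`
at the double zeros of `contactPoly (-A) (-B) m e`. -/
def slopeNumerator (A B u : ℝ) : ℝ :=
  8 * A * (u + u ^ 5) + B * (3 * u ^ 6 - 5 * u ^ 4 + 5 * u ^ 2 - 3)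

lemma slopeNumerator_mono {A B u v : ℝ} (hA : 0 ≤ A) (hB : 0 ≤ B) (hu : 0 < u) (huv : u ≤ v) :
    slopeNumerator A B u ≤ slopeNumerator A B v := by
  unfold slopeNumerator
  have h2 : u ^ 2 ≤ v ^ 2 := by gcongr
  have h5 : u ^ 5 ≤ v ^ 5 := by gcongr
  have h : 3 * u ^ 6 - 5 * u ^ 4 + 5 * u ^ 2 - 3 ≤ 3 * v ^ 6 - 5 * v ^ 4 + 5 * v ^ 2 - 3 := by
    have : 0 ≤ (v ^ 2 - u ^ 2) *
        (3 * (v ^ 4 + v ^ 2 * u ^ 2 + u ^ 4) - 5 * (v ^ 2 + u ^ 2) + 5) := by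
      refine mul_nonneg (by linarith) ?_
      nlinarith [sq_nonneg (u ^ 2 - v ^ 2), sq_nonneg (9 * (u ^ 2 + v ^ 2) - 10)]
    nlinarith
  have := mul_le_mul_of_nonneg_left h hB
  have := mul_le_mul_of_nonneg_left (add_le_add huv h5) hA
  nlinarith

lemma hasDerivAt_slope (A B : ℝ) {u : ℝ} (hu : 0 < u) :
    HasDerivAt (fun u : ℝ => 4 * A * ((u ^ 2)⁻¹ - u ^ 2) -
      B * ((u ^ 3)⁻¹ - 5 * u⁻¹ - 5 * u + u ^ 3)) (-(slopeNumerator A B u / u ^ 4)) u := by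
  have h1 := hasDerivAt_id' u
  have := (((h1.fun_pow 2).fun_inv (pow_ne_zero 2 hu.ne')).fun_sub (h1.fun_pow 2)).const_mul (4 * A)
    |>.fun_sub ((((((h1.fun_pow 3).fun_inv (pow_ne_zero 3 hu.ne')).fun_sub
      ((h1.fun_inv hu.ne').const_mul 5)).fun_sub (h1.const_mul 5)).fun_add (h1.fun_pow 3)).const_mul B)
  refine this.congr_deriv ?_
  unfold slopeNumerator
  field_simp
  push_cast
  ring

/-- When `a, b < 0`, Descartes' rule is not sufficient. The combination
`(1 + u ^ 2) * G' - 6 * u * G` no longer involves `e`, and says that an explicit function takes the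
value `3 * m` at every double zero. By Rolle's theorem its derivative vanishes between two double
zeros; but the numerator of minus that derivative is increasing, and it is already positive at the
first double zero. -/
lemma contact_unique_of_neg_of_neg {a b m e u v : ℝ} (hm : 0 ≤ m) (hb : b < 0) (ha : a < 0)
    (hea : 0 < e + a)
    (hu : 0 < u) (huv : u < v) (h1 : contactPoly a b m e u = 0)
    (h1' : contactPolyDeriv a b m e u = 0)
    (h2 : contactPoly a b m e v = 0) (h2' : contactPolyDeriv a b m e v = 0) : False := by
  have key : ∀ w, contactPoly a b m e w = 0 → contactPolyDeriv a b m e w = 0 →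
      4 * -a * (w - w ^ 5) - -b * (1 - 5 * w ^ 2 - 5 * w ^ 4 + w ^ 6) = 3 * m * w ^ 3 := by
    intro w h h'
    unfold contactPoly at h
    unfold contactPolyDeriv at h'
    linear_combination (-(1 + w ^ 2) / 8) * h' + (6 * w / 8) * h
  have key' : ∀ w, 0 < w → contactPoly a b m e w = 0 → contactPolyDeriv a b m e w = 0 →
      4 * -a * ((w ^ 2)⁻¹ - w ^ 2) - -b * ((w ^ 3)⁻¹ - 5 * w⁻¹ - 5 * w + w ^ 3) = 3 * m := by
    intro w hw h h'
    have := key w h h'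
    field_simp
    linear_combination this
  have hv : 0 < v := hu.trans huv
  obtain ⟨ξ, ⟨hξ1, hξ2⟩, hξ⟩ := exists_hasDerivAt_eq_zero huv
    (fun x hx => (hasDerivAt_slope (-a) (-b) (hu.trans_le hx.1)).continuousAt.continuousWithinAt)
    ((key' u hu h1 h1').trans (key' v hv h2 h2').symm)
    (fun x hx => hasDerivAt_slope (-a) (-b) (hu.trans hx.1))
  have hξ0 : 0 < ξ := hu.trans hξ1
  have hz : slopeNumerator (-a) (-b) ξ = 0 := by
    have := neg_eq_zero.1 hξ
    rcases div_eq_zero_iff.1 this with h | h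
    · exact h
    · exact absurd h (pow_ne_zero 4 hξ0.ne')
  have hmono := slopeNumerator_mono (A := -a) (B := -b) (by linarith) (by linarith) hu hξ1.le
  have hpos : 0 < slopeNumerator (-a) (-b) u := by
    rcases le_or_gt 1 u with hu1 | hu1
    · refine lt_of_lt_of_le ?_
        (slopeNumerator_mono (A := -a) (B := -b) (by linarith) (by linarith) one_pos hu1)
      unfold slopeNumerator
      nlinarith
    · -- `P1` comes from `G u = 0` and `P2` from the critical point equation; the numerator is a
      -- combination of the two with positive coefficients.
      have P1 : 0 < a * (1 - 6 * u ^ 2 + u ^ 4) + 4 * b * u * (1 - u ^ 2) := by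
        have hp : 0 < (e + a) * (1 + u ^ 2) ^ 3 + m * (6 * u ^ 4 + 2 * u ^ 6) := by positivity
        unfold contactPoly at h1
        have : (e + a) * (1 + u ^ 2) ^ 3 + m * (6 * u ^ 4 + 2 * u ^ 6) = 2 * (1 + u ^ 2) *
            (a * (1 - 6 * u ^ 2 + u ^ 4) + 4 * b * u * (1 - u ^ 2)) := by
          linear_combination h1
        rw [this] at hp
        exact pos_of_mul_pos_right hp (by positivity)
      have P2 : 0 ≤ -(4 * a * u * (1 - u ^ 2)) + b * (1 - 6 * u ^ 2 + u ^ 4) := by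
        have hp : 0 ≤ 3 * m * u ^ 3 := by positivity
        rw [← key u h1 h1', show 4 * -a * (u - u ^ 5) - -b * (1 - 5 * u ^ 2 - 5 * u ^ 4 + u ^ 6) =
          (1 + u ^ 2) * (-(4 * a * u * (1 - u ^ 2)) + b * (1 - 6 * u ^ 2 + u ^ 4)) by ring] at hp
        exact nonneg_of_mul_nonneg_right hp (by positivity)
      have : slopeNumerator (-a) (-b) u = 4 * u * (a * (1 - 6 * u ^ 2 + u ^ 4) +
          4 * b * u * (1 - u ^ 2)) + 3 * (1 - u ^ 2) * (-(4 * a * u * (1 - u ^ 2)) +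
          b * (1 - 6 * u ^ 2 + u ^ 4)) := by
        unfold slopeNumerator
        ring
      rw [this]
      have : 0 < 1 - u ^ 2 := by nlinarith
      positivity
  linarith

/-- A plane which supports the top disc (`a ^ 2 + b ^ 2 ≤ e ^ 2`) and the curve `γ`, is not
horizontal, and does not face downwards, touches `γ` at most once in the open parameter interval. -/
lemma contactPoly_zero_unique {a b m e u v : ℝ} (hm : 0 ≤ m) (hn : 0 < a ^ 2 + b ^ 2)
    (he : 0 ≤ e) (hne : a ^ 2 + b ^ 2 ≤ e ^ 2) (hG : ∀ w, 0 < w → 0 ≤ contactPoly a b m e w)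
    (hu : 0 < u) (hv : 0 < v) (h1 : contactPoly a b m e u = 0)
    (h2 : contactPoly a b m e v = 0) : u = v := by
  wlog huv : u < v generalizing u v
  · rcases (not_lt.1 huv).eq_or_lt with h | h
    · exact h.symm
    · exact (this hv hu h2 h1 h).symm
  exfalso
  have h1' := contactPolyDeriv_eq_zero hG hu h1
  have h2' := contactPolyDeriv_eq_zero hG hv h2
  have hae : |a| ≤ e := abs_le_of_sq_le_sq (by nlinarith) he
  have hae' := abs_le.1 hae
  have hb0 : b ≠ 0 → |a| < e := fun hb => by
    refine abs_lt_of_sq_lt_sq ?_ he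
    have : 0 < b ^ 2 := by positivity
    linarith
  rcases lt_or_ge b 0 with hb | hb
  · have h := abs_lt.1 (hb0 hb.ne)
    rcases lt_or_ge a 0 with ha | ha
    · exact contact_unique_of_neg_of_neg hm hb ha (by linarith) hu huv h1 h1' h2 h2'
    · exact contact_unique_of_neg_right hm hb ha h.2 hu huv h1 h1' h2 h2'
  · rcases hae'.2.lt_or_eq with h | h
    · exact contact_unique_of_nonneg_right hm hb h hu huv h1 h1' h2 h2'
    · have hb' : b = 0 := by
        by_contra hb'
        have := (abs_lt.1 (hb0 hb')).2
        linarith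
      have ha : 0 < a := by
        rcases (h ▸ he : 0 ≤ a).lt_or_eq with h | h
        · exact h
        · rw [← h, hb'] at hn
          norm_num at hn
      subst hb' h
      unfold contactPoly at h1
      have : 0 < 16 * a * u ^ 2 + 16 * a * u ^ 4 + m * (6 * u ^ 4 + 2 * u ^ 6) := by positivity
      nlinarith

/-! ### The cone and its generators -/

lemma inner_four (x y : E4) :
    inner ℝ x y = x 0 * y 0 + x 1 * y 1 + x 2 * y 2 + x 3 * y 3 := by
  simp [PiLp.inner_apply, Fin.sum_univ_four, mul_comm]

lemma ext_four {x y : E4} (h0 : x 0 = y 0) (h1 : x 1 = y 1) (h2 : x 2 = y 2) (h3 : x 3 = y 3) :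
    x = y := by
  ext i
  fin_cases i <;> assumption

@[simp] lemma lift_zero (x : EuclideanSpace ℝ (Fin 3)) : lift x 0 = x 0 := rfl
@[simp] lemma lift_one (x : EuclideanSpace ℝ (Fin 3)) : lift x 1 = x 1 := rfl
@[simp] lemma lift_two (x : EuclideanSpace ℝ (Fin 3)) : lift x 2 = x 2 := rfl
@[simp] lemma lift_three (x : EuclideanSpace ℝ (Fin 3)) : lift x 3 = 1 := rfl

lemma lift_combo {a b : ℝ} (hab : a + b = 1) (x y : EuclideanSpace ℝ (Fin 3)) :
    lift (a • x + b • y) = a • lift x + b • lift y := by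
  apply ext_four <;> simp [hab]

lemma convex_C : Convex ℝ C := convex_convexHull ℝ _

lemma smul_mem_K {l : ℝ} (hl : 0 ≤ l) {x : E4} (hx : x ∈ K) : l • x ∈ K := by
  obtain ⟨k, hk, p, hp, rfl⟩ := hx
  exact ⟨l * k, mul_nonneg hl hk, p, hp, smul_smul l k p⟩

lemma lift_mem_K {p : EuclideanSpace ℝ (Fin 3)} (hp : p ∈ C) : lift p ∈ K :=
  ⟨1, zero_le_one, lift p, ⟨p, hp, rfl⟩, (one_smul ℝ _).symm⟩

lemma add_mem_K {x y : E4} (hx : x ∈ K) (hy : y ∈ K) : x + y ∈ K := by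
  obtain ⟨l, hl, _, ⟨p, hp, rfl⟩, rfl⟩ := hx
  obtain ⟨k, hk, _, ⟨q, hq, rfl⟩, rfl⟩ := hy
  rcases (add_nonneg hl hk).eq_or_lt with h | h
  · have h1 : l = 0 := by linarith
    have h2 : k = 0 := by linarith
    subst h1 h2
    exact ⟨0, le_rfl, lift p, ⟨p, hp, rfl⟩, by simp⟩
  · have h1 : l / (l + k) + k / (l + k) = 1 := by field_simp
    refine ⟨l + k, h.le, _, ⟨_, convex_C hp hq (by positivity) (by positivity) h1, rfl⟩, ?_⟩
    rw [lift_combo h1, smul_add, smul_smul, smul_smul, mul_div_cancel₀ _ h.ne',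
      mul_div_cancel₀ _ h.ne']

lemma convex_K : Convex ℝ K := fun _ hx _ hy _ _ ha hb _ =>
  add_mem_K (smul_mem_K ha hx) (smul_mem_K hb hy)

lemma exists_angle {p q : ℝ} (h : p ^ 2 + q ^ 2 = 1) :
    ∃ s ∈ Set.Icc 0 (2 * Real.pi), Real.cos s = p ∧ Real.sin s = q := by
  have hp' := abs_le.1 (abs_le_one_iff_mul_self_le_one.2 (by nlinarith) : |p| ≤ 1)
  have hs : √(1 - p ^ 2) = |q| := by
    rw [← Real.sqrt_sq_eq_abs]
    congr 1
    linarith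
  have h0 := Real.arccos_nonneg p
  have h1 := Real.arccos_le_pi p
  rcases le_total 0 q with hq | hq
  · exact ⟨Real.arccos p, ⟨h0, by linarith⟩, Real.cos_arccos hp'.1 hp'.2, by
      rw [Real.sin_arccos, hs, abs_of_nonneg hq]⟩
  · refine ⟨2 * Real.pi - Real.arccos p, ⟨by linarith, by linarith⟩, ?_, ?_⟩
    · rw [Real.cos_two_pi_sub, Real.cos_arccos hp'.1 hp'.2]
    · rw [Real.sin_two_pi_sub, Real.sin_arccos, hs, abs_of_nonpos hq, neg_neg]

/-- The point `(p, q)` of the plane, lifted at height `1`. -/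
def topPt (p q : ℝ) : E4 := !₂[p, q, 1, 1]
/-- The point `(p, q)` of the plane, lifted at height `-1`. -/
def botPt (p q : ℝ) : E4 := !₂[p, q, -1, 1]

@[simp] lemma topPt_zero (p q : ℝ) : topPt p q 0 = p := rfl
@[simp] lemma topPt_one (p q : ℝ) : topPt p q 1 = q := rfl
@[simp] lemma topPt_two (p q : ℝ) : topPt p q 2 = 1 := rfl
@[simp] lemma topPt_three (p q : ℝ) : topPt p q 3 = 1 := rfl
@[simp] lemma botPt_zero (p q : ℝ) : botPt p q 0 = p := rfl
@[simp] lemma botPt_one (p q : ℝ) : botPt p q 1 = q := rfl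
@[simp] lemma botPt_two (p q : ℝ) : botPt p q 2 = -1 := rfl
@[simp] lemma botPt_three (p q : ℝ) : botPt p q 3 = 1 := rfl

lemma γ_zero (t : ℝ) : γ t 0 = 2 * Real.cos (2 * t) - 1 := rfl
lemma γ_one (t : ℝ) : γ t 1 = 2 * Real.sin (2 * t) := rfl
lemma γ_two (t : ℝ) : γ t 2 = 1 - (1 - Real.cos t) ^ 2 * (2 + Real.cos t) / 2 := by
  change 9 / 8 * Real.cos t - 1 / 8 * Real.cos (3 * t) = _
  rw [Real.cos_three_mul]
  ring

lemma topPt_mem_K {p q : ℝ} (h : p ^ 2 + q ^ 2 = 1) : topPt p q ∈ K := by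
  obtain ⟨s, hs, rfl, rfl⟩ := exists_angle h
  exact lift_mem_K (p := α s) (subset_convexHull ℝ _ (Or.inl (Or.inl ⟨s, hs, rfl⟩)))

lemma botPt_mem_K {p q : ℝ} (h : p ^ 2 + q ^ 2 = 1) : botPt p q ∈ K := by
  obtain ⟨s, hs, rfl, rfl⟩ := exists_angle h
  exact lift_mem_K (p := β s) (subset_convexHull ℝ _ (Or.inl (Or.inr ⟨s, hs, rfl⟩)))

lemma γ_mem_K {t : ℝ} (ht : t ∈ Set.Icc 0 Real.pi) : lift (γ t) ∈ K :=
  lift_mem_K (subset_convexHull ℝ _ (Or.inr ⟨t, ht, rfl⟩))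

lemma γ_at_zero : lift (γ 0) = topPt 1 0 := by
  apply ext_four
  · simp [γ_zero]; norm_num
  · simp [γ_one]
  · simp [γ_two]
  · rfl

lemma γ_at_pi : lift (γ Real.pi) = botPt 1 0 := by
  apply ext_four
  · simp [γ_zero]; norm_num
  · simp [γ_one]
  · simp [γ_two]; norm_num
  · rfl

lemma zero_mem_K : (0 : E4) ∈ K := by
  simpa using smul_mem_K le_rfl (topPt_mem_K (p := 1) (q := 0) (by norm_num))

/-- `K` is the smallest convex cone containing the two lifted circles and the lifted interior of the
curve `γ`; the end points of `γ` lie on the circles. -/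
lemma K_subset {Q : Set E4} (hadd : ∀ x ∈ Q, ∀ y ∈ Q, x + y ∈ Q)
    (hsmul : ∀ l : ℝ, 0 ≤ l → ∀ x ∈ Q, l • x ∈ Q)
    (htop : ∀ p q : ℝ, p ^ 2 + q ^ 2 = 1 → topPt p q ∈ Q)
    (hbot : ∀ p q : ℝ, p ^ 2 + q ^ 2 = 1 → botPt p q ∈ Q)
    (hγ : ∀ t ∈ Set.Ioo 0 Real.pi, lift (γ t) ∈ Q) : K ⊆ Q := by
  have hC : C ⊆ {p | lift p ∈ Q} := by
    refine convexHull_min ?_ ?_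
    · rintro _ ((⟨s, -, rfl⟩ | ⟨s, -, rfl⟩) | ⟨t, ht, rfl⟩)
      · exact htop _ _ (Real.cos_sq_add_sin_sq s)
      · exact hbot _ _ (Real.cos_sq_add_sin_sq s)
      · rcases ht.1.eq_or_lt with rfl | h0
        · change lift (γ 0) ∈ Q
          rw [γ_at_zero]
          exact htop _ _ (by norm_num)
        · rcases ht.2.eq_or_lt with rfl | h1
          · change lift (γ Real.pi) ∈ Q
            rw [γ_at_pi]
            exact hbot _ _ (by norm_num)
          · exact hγ t ⟨h0, h1⟩
    · intro x hx y hy a b ha hb hab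
      change lift _ ∈ Q
      rw [lift_combo hab]
      exact hadd _ (hsmul a ha _ hx) _ (hsmul b hb _ hy)
  rintro _ ⟨l, hl, _, ⟨p, hp, rfl⟩, rfl⟩
  exact hsmul l hl _ (hC hp)

lemma mem_dualCone_K {y : E4} (htop : ∀ p q : ℝ, p ^ 2 + q ^ 2 = 1 → 0 ≤ inner ℝ (topPt p q) y)
    (hbot : ∀ p q : ℝ, p ^ 2 + q ^ 2 = 1 → 0 ≤ inner ℝ (botPt p q) y)
    (hγ : ∀ t ∈ Set.Ioo 0 Real.pi, 0 ≤ inner ℝ (lift (γ t)) y) : y ∈ dualCone K :=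
  K_subset (Q := {x | 0 ≤ inner ℝ x y})
    (fun x hx z hz => by
      change 0 ≤ inner ℝ (x + z) y
      rw [inner_add_left]
      exact add_nonneg hx hz)
    (fun l hl x hx => by
      change 0 ≤ inner ℝ (l • x) y
      rw [real_inner_smul_left]
      exact mul_nonneg hl hx) htop hbot hγ

/-- The part of `K` on which `y ∈ K*` vanishes is generated by the generators on which `y`
vanishes. -/
lemma mem_of_inner_eq_zero {Q : Set E4} {y : E4} (hy : y ∈ dualCone K)
    (hadd : ∀ x ∈ Q, ∀ y ∈ Q, x + y ∈ Q)
    (hsmul : ∀ l : ℝ, 0 ≤ l → ∀ x ∈ Q, l • x ∈ Q) (hzero : (0 : E4) ∈ Q)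
    (htop : ∀ p q : ℝ, p ^ 2 + q ^ 2 = 1 → inner ℝ (topPt p q) y = 0 → topPt p q ∈ Q)
    (hbot : ∀ p q : ℝ, p ^ 2 + q ^ 2 = 1 → inner ℝ (botPt p q) y = 0 → botPt p q ∈ Q)
    (hγ : ∀ t ∈ Set.Ioo 0 Real.pi, inner ℝ (lift (γ t)) y = 0 → lift (γ t) ∈ Q)
    {x : E4} (hx : x ∈ K) (hxy : inner ℝ x y = 0) : x ∈ Q := by
  refine (K_subset (Q := {x | 0 ≤ inner ℝ x y ∧ (inner ℝ x y = 0 → x ∈ Q)}) ?_ ?_ ?_ ?_ ?_ hx).2 hxy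
  · rintro x ⟨hx, hx'⟩ z ⟨hz, hz'⟩
    simp only [Set.mem_ofPred_eq, inner_add_left]
    exact ⟨add_nonneg hx hz, fun h => hadd _ (hx' (by linarith)) _ (hz' (by linarith))⟩
  · rintro l hl x ⟨hx, hx'⟩
    simp only [Set.mem_ofPred_eq, real_inner_smul_left]
    refine ⟨mul_nonneg hl hx, fun h => ?_⟩
    rcases mul_eq_zero.1 h with rfl | h
    · rwa [zero_smul]
    · exact hsmul l hl x (hx' h)
  · exact fun p q h => ⟨hy _ (topPt_mem_K h), htop p q h⟩
  · exact fun p q h => ⟨hy _ (botPt_mem_K h), hbot p q h⟩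
  · exact fun t h => ⟨hy _ (γ_mem_K ⟨h.1.le, h.2.le⟩), hγ t h⟩

/-- By Carathéodory's theorem, the convex hull is a finite union of continuous images of products of
a standard simplex with powers of the set. -/
lemma isCompact_convexHull {E : Type*} [NormedAddCommGroup E] [NormedSpace ℝ E]
    [FiniteDimensional ℝ E] {s : Set E} (hs : IsCompact s) : IsCompact (convexHull ℝ s) := by
  have h : convexHull ℝ s = ⋃ k ∈ Set.Iic (Module.finrank ℝ E + 1),
      (fun x : (Fin k → ℝ) × (Fin k → E) => ∑ i, x.1 i • x.2 i) ''
        (stdSimplex ℝ (Fin k) ×ˢ Set.univ.pi fun _ => s) := by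
    ext x
    simp only [Set.mem_iUnion, Set.mem_image, Set.mem_prod, Prod.exists, Set.mem_univ_pi]
    constructor
    · intro hx
      obtain ⟨ι, _, z, w, hz, hind, hw, hw1, hx⟩ := eq_pos_convex_span_of_mem_convexHull hx
      let g := (Fintype.equivFin ι).symm
      refine ⟨Fintype.card ι, ?_, fun i => w (g i), fun i => z (g i),
        ⟨⟨fun i => (hw _).le, ?_⟩, fun i => hz ⟨_, rfl⟩⟩, ?_⟩
      · have := hind.card_le_finrank_succ
        exact this.trans (Nat.succ_le_succ (Submodule.finrank_le _))
      · rw [← hw1]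
        exact g.sum_comp w
      · rw [← hx]
        exact g.sum_comp fun i => w i • z i
    · rintro ⟨k, -, w, z, ⟨hw, hz⟩, rfl⟩
      exact mem_convexHull_of_exists_fintype w z hw.1 hw.2 hz rfl
  rw [h]
  refine (Set.finite_Iic _).isCompact_biUnion fun k _ => ?_
  refine IsCompact.image ((isCompact_stdSimplex ℝ (Fin k)).prod
    (isCompact_univ_pi fun _ => hs)) ?_
  fun_prop

lemma isCompact_C : IsCompact C := by
  refine isCompact_convexHull ?_
  have hα : Continuous α := by unfold α; fun_prop
  have hβ : Continuous β := by unfold β; fun_prop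
  have hγ : Continuous γ := by unfold γ; fun_prop
  exact ((isCompact_Icc.image hα).union (isCompact_Icc.image hβ)).union (isCompact_Icc.image hγ)

/-- The last coordinate of a point of `K` is its scaling factor, so a convergent sequence in `K` has
convergent factors, and a subsequence of its directions converges in the compact base. -/
lemma isClosed_K : IsClosed K := by
  have hc : IsCompact (lift '' C) := by
    refine isCompact_C.image ?_
    unfold lift
    fun_prop
  refine IsSeqClosed.isClosed ?_
  intro y x hy hx
  choose l hl p hp hlp using hy
  have h3 : ∀ n, l n = y n 3 := fun n => by
    obtain ⟨q, -, hq⟩ := hp n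
    rw [hlp, ← hq]
    simp
  obtain ⟨q, hq, φ, hφ, hlim⟩ := hc.tendsto_subseq hp
  have hcont : Continuous fun z : E4 => z 3 := by fun_prop
  have hl3 : Filter.Tendsto l Filter.atTop (nhds (x 3)) := by
    rw [funext h3]
    exact (hcont.tendsto x).comp hx
  refine ⟨x 3, ge_of_tendsto' hl3 hl, q, hq, ?_⟩
  refine tendsto_nhds_unique (hx.comp hφ.tendsto_atTop) ?_
  have := (hl3.comp hφ.tendsto_atTop).smul hlim
  refine this.congr fun n => ?_
  simp [hlp]

lemma span_K : Submodule.span ℝ K = ⊤ := by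
  rw [eq_top_iff]
  intro x _
  have t1 := Submodule.subset_span (R := ℝ) (topPt_mem_K (p := 1) (q := 0) (by norm_num))
  have t2 := Submodule.subset_span (R := ℝ) (topPt_mem_K (p := -1) (q := 0) (by norm_num))
  have t3 := Submodule.subset_span (R := ℝ) (topPt_mem_K (p := 0) (q := 1) (by norm_num))
  have t4 := Submodule.subset_span (R := ℝ) (botPt_mem_K (p := 1) (q := 0) (by norm_num))
  have : x = ((x 0 + (x 3 + x 2) / 2 - x 1 - (x 3 - x 2) / 2) / 2) • topPt 1 0 +
      (((x 3 + x 2) / 2 - x 1 - x 0 + (x 3 - x 2) / 2) / 2) • topPt (-1) 0 +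
      x 1 • topPt 0 1 + ((x 3 - x 2) / 2) • botPt 1 0 := by
    apply ext_four <;> simp <;> ring
  rw [this]
  exact add_mem (add_mem (add_mem (Submodule.smul_mem _ _ t1) (Submodule.smul_mem _ _ t2))
    (Submodule.smul_mem _ _ t3)) (Submodule.smul_mem _ _ t4)

/-! ### Faces of the cone -/

lemma vertex_mem_dualCone : (!₂[0, 0, 0, 1] : E4) ∈ dualCone K := by
  refine mem_dualCone_K ?_ ?_ ?_ <;> intros <;> rw [inner_four] <;> simp

/-- On a ray every functional is proportional to the last coordinate, which is positive on `K`. -/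
lemma exists_dual_of_ray {F : Set E4} {p z : E4} (hp : 0 < p 3) (hpF : p ∈ F)
    (hray : ∀ x ∈ F, ∃ l : ℝ, x = l • p) (hz : z ∈ dualCone F) :
    ∃ w ∈ dualCone K, ∀ x ∈ F, inner ℝ x w = inner ℝ x z := by
  refine ⟨(inner ℝ p z / p 3) • !₂[0, 0, 0, 1], fun x hx => ?_, fun x hx => ?_⟩
  · rw [real_inner_smul_right]
    exact mul_nonneg (div_nonneg (hz p hpF) hp.le) (vertex_mem_dualCone x hx)
  · obtain ⟨l, rfl⟩ := hray x hx
    have : inner ℝ p (!₂[0, 0, 0, 1] : E4) = p 3 := by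
      rw [inner_four]
      simp
    rw [real_inner_smul_right, real_inner_smul_left, real_inner_smul_left, this]
    field_simp

namespace IsFace

variable {F : Set E4}

lemma zero_mem (hF : IsFace F K) : (0 : E4) ∈ F := by
  obtain ⟨x, hx⟩ := hF.nonempty
  have hxK := hF.extreme.subset hx
  refine hF.extreme.left_mem_of_mem_openSegment zero_mem_K (smul_mem_K (l := 2) (by norm_num) hxK)
    hx ?_
  exact ⟨1 / 2, 1 / 2, by norm_num, by norm_num, by norm_num, by simp [smul_smul]⟩

lemma smul_mem (hF : IsFace F K) {x : E4} (hx : x ∈ F) {l : ℝ} (hl : 0 ≤ l) : l • x ∈ F := by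
  rcases hl.eq_or_lt with rfl | hl
  · rw [zero_smul]
    exact hF.zero_mem
  have hxK := hF.extreme.subset hx
  have h1 : (l + 1) • x ∈ F := by
    refine hF.extreme.left_mem_of_mem_openSegment (smul_mem_K (by linarith) hxK) zero_mem_K hx ?_
    refine ⟨1 / (l + 1), l / (l + 1), by positivity, by positivity, by field_simp; ring, ?_⟩
    rw [smul_smul, smul_zero, add_zero, div_mul_cancel₀ _ (by positivity), one_smul]
  have h2 := hF.convex h1 hF.zero_mem (a := l / (l + 1)) (b := 1 / (l + 1)) (by positivity)
    (by positivity) (by field_simp)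
  rwa [smul_zero, add_zero, smul_smul, div_mul_cancel₀ _ (by positivity)] at h2

lemma add_mem (hF : IsFace F K) {x y : E4} (hx : x ∈ F) (hy : y ∈ F) : x + y ∈ F := by
  have := hF.smul_mem (hF.convex hx hy (a := 1 / 2) (b := 1 / 2) (by norm_num) (by norm_num)
    (by norm_num)) (l := 2) (by norm_num)
  simpa [smul_smul] using this

lemma mem_of_smul_mem (hF : IsFace F K) {x : E4} {l : ℝ} (hl : 0 < l) (h : l • x ∈ F) :
    x ∈ F := by
  have := hF.smul_mem h (inv_nonneg.2 hl.le)
  rwa [smul_smul, inv_mul_cancel₀ hl.ne', one_smul] at this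

lemma mem_of_add_mem (hF : IsFace F K) {x y : E4} (hx : x ∈ K) (hy : y ∈ K) (h : x + y ∈ F) :
    x ∈ F := by
  refine hF.mem_of_smul_mem (l := 2) (by norm_num) ?_
  refine hF.extreme.left_mem_of_mem_openSegment (smul_mem_K (by norm_num) hx)
    (smul_mem_K (l := 2) (by norm_num) hy) h ?_
  exact ⟨1 / 2, 1 / 2, by norm_num, by norm_num, by norm_num, by simp [smul_smul]⟩

/-- A face other than `K` misses the interior of `K`, hence lies in a supporting hyperplane. -/
lemma exists_perp (hF : IsFace F K) (hne : F ≠ K) :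
    ∃ y ∈ dualCone K, y ≠ 0 ∧ ∀ x ∈ F, inner ℝ x y = 0 := by
  have hint : (interior K).Nonempty := by
    have h := affineSpan_insert_zero (k := ℝ) K
    rw [Set.insert_eq_of_mem zero_mem_K, span_K] at h
    rw [convex_K.interior_nonempty_iff_affineSpan_eq_top]
    exact SetLike.coe_injective (by simpa using h)
  have hdisj : Disjoint (interior K) F := by
    rw [Set.disjoint_left]
    intro x hxi hxF
    refine hne (hF.extreme.subset.antisymm fun p hp => ?_)
    have hc : Continuous fun ε : ℝ => x - ε • p := by fun_prop
    have hnear : ∀ᶠ ε : ℝ in nhds 0, x - ε • p ∈ K :=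
      hc.continuousAt.preimage_mem_nhds (by simpa using mem_interior_iff_mem_nhds.1 hxi)
    obtain ⟨ε, hε, hε0⟩ := ((hnear.filter_mono nhdsWithin_le_nhds).and
      (self_mem_nhdsWithin (s := Set.Ioi (0 : ℝ)))).exists
    have hε0 : 0 < ε := hε0
    exact hF.mem_of_smul_mem hε0
      (hF.mem_of_add_mem (smul_mem_K hε0.le hp) hε (by simpa using hxF))
  obtain ⟨f, c, hfc, hcf⟩ :=
    geometric_hahn_banach_open convex_K.interior isOpen_interior hF.convex hdisj
  have hc : c ≤ 0 := by simpa using hcf 0 hF.zero_mem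
  have hK : ∀ x ∈ K, f x ≤ 0 := by
    intro x hx
    have hx' : x ∈ closure (interior K) := by
      rw [convex_K.closure_interior_eq_closure_of_nonempty_interior hint]
      exact subset_closure hx
    exact closure_minimal (t := {x | f x ≤ 0}) (fun z hz => ((hfc z hz).trans_le hc).le)
      (isClosed_le f.continuous continuous_const) hx'
  have hinner : ∀ x, inner ℝ x (-(InnerProductSpace.toDual ℝ E4).symm f) = -f x := by
    intro x
    rw [inner_neg_right, real_inner_comm, InnerProductSpace.toDual_symm_apply]
  refine ⟨-(InnerProductSpace.toDual ℝ E4).symm f, fun x hx => ?_, fun h0 => ?_, fun x hx => ?_⟩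
  · rw [hinner]
    linarith [hK x hx]
  · obtain ⟨x, hx⟩ := hint
    have h := hinner x
    rw [h0, inner_zero_right] at h
    linarith [hfc x hx]
  · rw [hinner]
    have h1 := hK x (hF.extreme.subset hx)
    by_contra h2
    have h3 : 0 < -f x := lt_of_le_of_ne (by linarith) (Ne.symm h2)
    -- `f` is bounded below by `c` on the cone `F`, so it cannot be negative there.
    have h4 := hcf _ (hF.smul_mem hx (l := (1 - c) / -f x) (by apply div_nonneg <;> linarith))
    rw [map_smul, smul_eq_mul] at h4
    have h5 : (1 - c) / -f x * f x = c - 1 := by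
      rw [div_mul_eq_mul_div, div_eq_iff h3.ne']
      ring
    linarith

/-- If `F` lies in the cone generated by `u` and `v`, and each of the two is separated from the other
by a functional of the dual cone vanishing on the other, then every functional which is nonnegative
on `F` agrees on `F` with a functional of the dual cone. -/
lemma exists_dual_of_pair (hF : IsFace F K) {u v yu yv z : E4} (hu : u ∈ K) (hv : v ∈ K)
    (hyu : yu ∈ dualCone K) (hyv : yv ∈ dualCone K) (huu : 0 < inner ℝ u yu)
    (huv : inner ℝ u yv = 0) (hvu : inner ℝ v yu = 0) (hvv : 0 < inner ℝ v yv)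
    (hpair : ∀ x ∈ F, ∃ s t : ℝ, 0 ≤ s ∧ 0 ≤ t ∧ x = s • u + t • v) (hz : z ∈ dualCone F) :
    ∃ w ∈ dualCone K, ∀ x ∈ F, inner ℝ x w = inner ℝ x z := by
  classical
  let A : E4 → ℝ := fun p => if p ∈ F then inner ℝ p z else 0
  have hA : ∀ p, 0 ≤ A p := fun p => by
    by_cases hp : p ∈ F
    · simpa [A, hp] using hz p hp
    · simp [A, hp]
  have hsA : ∀ p (s : ℝ), 0 ≤ s → s • p ∈ F → s * A p = s * inner ℝ p z := fun p s hs hsp => by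
    rcases hs.eq_or_lt with rfl | hs
    · simp
    · simp [A, hF.mem_of_smul_mem hs hsp]
  -- A generator outside `F` does not occur in the points of `F`, and gets coefficient `0`.
  refine ⟨(A u / inner ℝ u yu) • yu + (A v / inner ℝ v yv) • yv, fun x hx => ?_, fun x hx => ?_⟩
  · rw [inner_add_right, real_inner_smul_right, real_inner_smul_right]
    exact add_nonneg (mul_nonneg (div_nonneg (hA u) huu.le) (hyu x hx))
      (mul_nonneg (div_nonneg (hA v) hvv.le) (hyv x hx))
  · obtain ⟨s, t, hs, ht, rfl⟩ := hpair x hx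
    have hsu := hsA u s hs (hF.mem_of_add_mem (smul_mem_K hs hu) (smul_mem_K ht hv) hx)
    have htv := hsA v t ht (hF.mem_of_add_mem (smul_mem_K ht hv) (smul_mem_K hs hu)
      (by rwa [add_comm]))
    simp only [inner_add_left, inner_add_right, real_inner_smul_left, real_inner_smul_right, huv,
      hvu]
    rw [← hsu, ← htv]
    field_simp
    ring

end IsFace

/-! ### Supporting hyperplanes -/

lemma exists_tan_half {t : ℝ} (ht : t ∈ Set.Ioo 0 Real.pi) :
    ∃ u : ℝ, 0 < u ∧ Real.cos t = (1 - u ^ 2) / (1 + u ^ 2) ∧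
      Real.sin t = 2 * u / (1 + u ^ 2) := by
  have hs := Real.sin_pos_of_mem_Ioo ht
  have hsc := Real.sin_sq_add_cos_sq t
  have hc : 0 < 1 + Real.cos t := by nlinarith [Real.neg_one_le_cos t]
  have h1 : 1 + (Real.sin t / (1 + Real.cos t)) ^ 2 = 2 / (1 + Real.cos t) := by
    field_simp
    linear_combination hsc
  refine ⟨Real.sin t / (1 + Real.cos t), by positivity, ?_, ?_⟩
  · rw [h1]
    field_simp
    linear_combination hsc
  · rw [h1]
    field_simp

lemma exists_of_tan_half {u : ℝ} (hu : 0 < u) :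
    ∃ t ∈ Set.Ioo 0 Real.pi, Real.cos t = (1 - u ^ 2) / (1 + u ^ 2) ∧
      Real.sin t = 2 * u / (1 + u ^ 2) := by
  have h0 := Real.arctan_pos.2 hu
  have h1 := Real.arctan_lt_pi_div_two u
  have hs : √(1 + u ^ 2) ^ 2 = 1 + u ^ 2 := Real.sq_sqrt (by positivity)
  have hs0 : 0 < √(1 + u ^ 2) := Real.sqrt_pos.2 (by positivity)
  refine ⟨2 * Real.arctan u, ⟨by linarith, by linarith⟩, ?_, ?_⟩
  · rw [Real.cos_two_mul, Real.cos_sq_arctan]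
    field_simp
    ring
  · rw [Real.sin_two_mul, Real.cos_arctan, Real.sin_arctan]
    field_simp
    rw [hs]

lemma inner_topPt (p q : ℝ) (y : E4) :
    inner ℝ (topPt p q) y = y 0 * p + y 1 * q + y 2 + y 3 := by
  rw [inner_four]
  simp
  ring

lemma inner_botPt (p q : ℝ) (y : E4) :
    inner ℝ (botPt p q) y = y 0 * p + y 1 * q - y 2 + y 3 := by
  rw [inner_four]
  simp
  ring

lemma inner_γ (t : ℝ) (y : E4) :
    inner ℝ (lift (γ t)) y = y 0 * (2 * Real.cos (2 * t) - 1) + y 1 * (2 * Real.sin (2 * t)) +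
      y 2 + y 3 - y 2 * ((1 - Real.cos t) ^ 2 * (2 + Real.cos t) / 2) := by
  rw [inner_four]
  simp only [lift_zero, lift_one, lift_two, lift_three, γ_zero, γ_one, γ_two]
  ring

lemma inner_γ_mul {t u : ℝ} (hc : Real.cos t = (1 - u ^ 2) / (1 + u ^ 2))
    (hs : Real.sin t = 2 * u / (1 + u ^ 2)) (y : E4) :
    inner ℝ (lift (γ t)) y * (1 + u ^ 2) ^ 3 =
      contactPoly (-y 0) (-y 1) (-y 2) (y 3 + y 2) u := by
  rw [inner_γ, Real.cos_two_mul, Real.sin_two_mul, hc, hs]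
  unfold contactPoly
  field_simp
  ring

/-- A supporting plane as in `contactPoly_zero_unique`, in terms of the dual cone. -/
lemma γ_contact_unique {y : E4} (hy : y ∈ dualCone K) (hn : 0 < y 0 ^ 2 + y 1 ^ 2)
    (hy2 : y 2 ≤ 0) (he : 0 ≤ y 3 + y 2) (hne : y 0 ^ 2 + y 1 ^ 2 ≤ (y 3 + y 2) ^ 2) {t s : ℝ}
    (ht : t ∈ Set.Ioo 0 Real.pi) (hs : s ∈ Set.Ioo 0 Real.pi)
    (hyt : inner ℝ (lift (γ t)) y = 0) (hys : inner ℝ (lift (γ s)) y = 0) : t = s := by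
  obtain ⟨u, hu, huc, hus⟩ := exists_tan_half ht
  obtain ⟨v, hv, hvc, hvs⟩ := exists_tan_half hs
  have h1 := inner_γ_mul huc hus y
  have h2 := inner_γ_mul hvc hvs y
  rw [hyt, zero_mul] at h1
  rw [hys, zero_mul] at h2
  have huv : u = v := by
    refine contactPoly_zero_unique (by linarith) (by simpa using hn) he (by simpa using hne)
      (fun w hw => ?_) hu hv h1.symm h2.symm
    obtain ⟨r, hr, hrc, hrs⟩ := exists_of_tan_half hw
    rw [← inner_γ_mul hrc hrs]
    exact mul_nonneg (hy _ (γ_mem_K ⟨hr.1.le, hr.2.le⟩)) (by positivity)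
  refine Real.injOn_cos ⟨ht.1.le, ht.2.le⟩ ⟨hs.1.le, hs.2.le⟩ ?_
  rw [huc, hvc, huv]

/-- An affine function nonnegative on the unit circle dominates the norm of its linear part. -/
lemma sq_add_sq_le_of_forall_circle {a b c : ℝ}
    (h : ∀ p q : ℝ, p ^ 2 + q ^ 2 = 1 → 0 ≤ a * p + b * q + c) :
    0 ≤ c ∧ a ^ 2 + b ^ 2 ≤ c ^ 2 := by
  have hc : 0 ≤ c := by
    have h1 := h 1 0 (by norm_num)
    have h2 := h (-1) 0 (by norm_num)
    linarith
  refine ⟨hc, ?_⟩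
  obtain ⟨r, hr0, hr⟩ : ∃ r : ℝ, 0 ≤ r ∧ r ^ 2 = a ^ 2 + b ^ 2 :=
    ⟨√(a ^ 2 + b ^ 2), Real.sqrt_nonneg _, Real.sq_sqrt (by positivity)⟩
  rw [← hr]
  rcases hr0.eq_or_lt with rfl | h0
  · rw [zero_pow two_ne_zero]
    positivity
  · have h1 := h (-a / r) (-b / r) (by
      rw [div_pow, div_pow, ← add_div, neg_sq, neg_sq, ← hr, div_self (by positivity)])
    have h2 : a * (-a / r) + b * (-b / r) = -r := by
      field_simp
      linear_combination hr
    gcongr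
    linarith

/-- The equality case of the Cauchy-Schwarz inequality on the unit circle. -/
lemma circle_contact {a b c p q : ℝ} (hc : a ^ 2 + b ^ 2 ≤ c ^ 2)
    (hpq : p ^ 2 + q ^ 2 = 1) (h : a * p + b * q + c = 0) : a = -c * p ∧ b = -c * q := by
  have h1 : (a + c * p) ^ 2 + (b + c * q) ^ 2 ≤ 0 := by
    have : (a + c * p) ^ 2 + (b + c * q) ^ 2 = a ^ 2 + b ^ 2 - c ^ 2 := by
      linear_combination 2 * c * h + c ^ 2 * hpq
    linarith
  have h2 : a + c * p = 0 := by nlinarith [sq_nonneg (a + c * p), sq_nonneg (b + c * q)]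
  have h3 : b + c * q = 0 := by nlinarith [sq_nonneg (a + c * p), sq_nonneg (b + c * q)]
  constructor <;> linarith

lemma height_nonneg (t : ℝ) : 0 ≤ (1 - Real.cos t) ^ 2 * (2 + Real.cos t) / 2 := by
  have := Real.neg_one_le_cos t
  have : 0 ≤ 2 + Real.cos t := by linarith
  positivity

/-- The functional exposing the top disc. -/
lemma top_mem_dualCone : (!₂[0, 0, -1, 1] : E4) ∈ dualCone K := by
  refine mem_dualCone_K (fun p q _ => ?_) (fun p q _ => ?_) (fun t _ => ?_)
  · rw [inner_topPt]; simp
  · rw [inner_botPt]; simp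
  · rw [inner_γ]
    have := height_nonneg t
    simpa using this

/-- The functional exposing the bottom disc. -/
lemma bot_mem_dualCone : (!₂[0, 0, 1, 1] : E4) ∈ dualCone K := by
  refine mem_dualCone_K (fun p q _ => ?_) (fun p q _ => ?_) (fun t _ => ?_)
  · rw [inner_topPt]; simp
  · rw [inner_botPt]; simp
  · rw [inner_γ]
    simp
    have h1 := Real.neg_one_le_cos t
    have h2 := Real.cos_le_one t
    nlinarith [mul_nonneg (sq_nonneg (1 + Real.cos t)) (sub_nonneg.2 h2)]

/-- The vertical planes tangent to the disc of centre `(-1, 0)` and radius `2`, onto whose boundary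
circle `γ` projects, support `C`. -/
lemma tangent_mem_dualCone {c s : ℝ} (h : c ^ 2 + s ^ 2 = 1) :
    (!₂[-c, -s, 0, 2 - c] : E4) ∈ dualCone K := by
  have hle : ∀ p q : ℝ, p ^ 2 + q ^ 2 = 1 → c * p + s * q ≤ 1 := fun p q hpq => by
    nlinarith [sq_nonneg (c - p), sq_nonneg (s - q)]
  have hc := hle 1 0 (by norm_num)
  refine mem_dualCone_K (fun p q hpq => ?_) (fun p q hpq => ?_) (fun t _ => ?_)
  · rw [inner_topPt]
    simp
    linarith [hle p q hpq]
  · rw [inner_botPt]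
    simp
    linarith [hle p q hpq]
  · rw [inner_γ]
    simp
    linarith [hle _ _ (Real.cos_sq_add_sin_sq (2 * t))]

lemma cos_two_mul_lt_one {t : ℝ} (ht : t ∈ Set.Ioo 0 Real.pi) : Real.cos (2 * t) < 1 := by
  have := Real.sin_pos_of_mem_Ioo ht
  rw [Real.cos_two_mul']
  nlinarith [Real.sin_sq_add_cos_sq t]

/-! ### Faces in upward supporting hyperplanes -/

lemma height_pos {t : ℝ} (ht : t ∈ Set.Ioo 0 Real.pi) :
    0 < (1 - Real.cos t) ^ 2 * (2 + Real.cos t) / 2 := by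
  have h1 : Real.cos t < 1 := by
    have := Real.sin_pos_of_mem_Ioo ht
    nlinarith [Real.sin_sq_add_cos_sq t, Real.cos_le_one t]
  have h2 := Real.neg_one_le_cos t
  have : 0 < 2 + Real.cos t := by linarith
  have : 0 < 1 - Real.cos t := by linarith
  positivity

/-- An affine function which is nonnegative on the unit disc becomes nonnegative on `γ` when a
multiple of the height difference `1 - γ₂ t` is added. This difference vanishes only at the starting
point `(1, 0)`, to order four. If the function is positive at `(1, 0)`, a large multiple suffices; if
it vanishes there, its zero line is the common tangent of the two circles, and it is nonnegative on
`γ` by itself. -/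
lemma exists_height_multiple {A B Z : ℝ}
    (h : ∀ p q : ℝ, p ^ 2 + q ^ 2 = 1 → 0 ≤ A * p + B * q + Z) :
    ∃ M : ℝ, ∀ t : ℝ, 0 ≤ A * (2 * Real.cos (2 * t) - 1) + B * (2 * Real.sin (2 * t)) + Z +
      M * ((1 - Real.cos t) ^ 2 * (2 + Real.cos t) / 2) := by
  obtain ⟨hZ, hABZ⟩ := sq_add_sq_le_of_forall_circle h
  have hk : 0 ≤ A + Z := by simpa using h 1 0 (by norm_num)
  rcases hk.eq_or_lt with hk | hk
  · have hA : A = -Z := by linarith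
    have hB : B = 0 := by
      rw [hA] at hABZ
      nlinarith [sq_nonneg B]
    refine ⟨0, fun t => ?_⟩
    rw [hA, hB]
    nlinarith [mul_nonneg hZ (sub_nonneg.2 (Real.cos_le_one (2 * t)))]
  · set k := A + Z with hkdef
    set L := 12 * |A| + 8 * |B| + 1 with hL
    have hL0 : 0 < L := by positivity
    refine ⟨2 * L ^ 4 / k ^ 3, fun t => ?_⟩
    have hc1 := Real.cos_le_one t
    have hc2 := Real.neg_one_le_cos t
    obtain ⟨σ, hσ0, hσ⟩ : ∃ σ : ℝ, 0 ≤ σ ∧ σ ^ 2 = 1 - Real.cos t :=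
      ⟨√(1 - Real.cos t), Real.sqrt_nonneg _, Real.sq_sqrt (by linarith)⟩
    have hσ2 : 2 * σ ≤ 3 := by nlinarith
    have hcos : |2 * Real.cos (2 * t) - 2| ≤ 12 * σ := by
      rw [Real.cos_two_mul, abs_le]
      constructor <;> nlinarith
    have hsin : |2 * Real.sin (2 * t)| ≤ 8 * σ := by
      rw [Real.sin_two_mul]
      have h1 : |Real.sin t| ≤ 2 * σ := by
        refine abs_le_of_sq_le_sq ?_ (by linarith)
        nlinarith [Real.sin_sq_add_cos_sq t]
      have h2 := abs_le.2 ⟨hc2, hc1⟩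
      rw [abs_mul, abs_mul, abs_mul, abs_two]
      nlinarith [mul_le_mul h1 h2 (abs_nonneg _) (by linarith), abs_nonneg (Real.sin t)]
    -- The terms other than `k` are bounded below by `-L * σ`, and the height is at least `σ ^ 4 / 2`.
    have h1 : -(|A| * (12 * σ)) ≤ A * (2 * Real.cos (2 * t) - 2) :=
      (neg_le_neg (mul_le_mul_of_nonneg_left hcos (abs_nonneg A))).trans
        (by rw [← abs_mul]; exact neg_abs_le _)
    have h2 : -(|B| * (8 * σ)) ≤ B * (2 * Real.sin (2 * t)) :=
      (neg_le_neg (mul_le_mul_of_nonneg_left hsin (abs_nonneg B))).trans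
        (by rw [← abs_mul]; exact neg_abs_le _)
    have h3 : L ^ 4 * σ ^ 4 / k ^ 3 ≤
        2 * L ^ 4 / k ^ 3 * ((1 - Real.cos t) ^ 2 * (2 + Real.cos t) / 2) := by
      have : 2 * L ^ 4 / k ^ 3 * ((1 - Real.cos t) ^ 2 * (2 + Real.cos t) / 2) =
          L ^ 4 * σ ^ 4 / k ^ 3 * (2 + Real.cos t) := by
        rw [← hσ]
        ring
      rw [this]
      exact le_mul_of_one_le_right (by positivity) (by linarith)
    -- With `x = L * σ / k` this is `1 - x + x ^ 4 ≥ 0`.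
    have h4 : 0 ≤ k - L * σ + L ^ 4 * σ ^ 4 / k ^ 3 := by
      have : k - L * σ + L ^ 4 * σ ^ 4 / k ^ 3 =
          k * (1 - L * σ / k + (L * σ / k) ^ 4) := by
        field_simp
      rw [this]
      refine mul_nonneg hk.le ?_
      nlinarith [sq_nonneg ((L * σ / k) ^ 2 - 1 / 2), sq_nonneg (L * σ / k - 1 / 2)]
    have h5 : L * σ = |A| * (12 * σ) + |B| * (8 * σ) + σ := by
      rw [hL]
      ring
    linarith

/-- The face of `K` over the top disc is a circular cone. -/
lemma mem_lorentz_of_top {x : E4} (hx : x ∈ K) (hxy : x 2 = x 3) :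
    0 ≤ x 3 ∧ x 0 ^ 2 + x 1 ^ 2 ≤ x 3 ^ 2 := by
  refine mem_of_inner_eq_zero (Q := {x : E4 | 0 ≤ x 3 ∧ x 0 ^ 2 + x 1 ^ 2 ≤ x 3 ^ 2})
    top_mem_dualCone ?_ ?_ ?_ ?_ ?_ ?_ hx (by rw [inner_four]; simp [hxy])
  · rintro x ⟨hx, hx'⟩ y ⟨hy, hy'⟩
    refine ⟨add_nonneg hx hy, ?_⟩
    have h1 : x 0 * y 0 + x 1 * y 1 ≤ x 3 * y 3 := by
      refine le_of_sq_le_sq ?_ (mul_nonneg hx hy)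
      nlinarith [sq_nonneg (x 0 * y 1 - x 1 * y 0), mul_le_mul hx' hy' (by positivity)
        (by positivity)]
    simp only [PiLp.add_apply]
    nlinarith
  · rintro l hl x ⟨hx, hx'⟩
    refine ⟨mul_nonneg hl hx, ?_⟩
    simp only [PiLp.smul_apply, smul_eq_mul]
    nlinarith [mul_le_mul_of_nonneg_left hx' (sq_nonneg l)]
  · simp
  · intro p q h _
    simp [h]
  · intro p q h hi
    rw [inner_botPt] at hi
    simp at hi
  · intro t ht hi
    rw [inner_γ] at hi
    have := height_pos ht
    simp at hi
    rcases hi with hi | hi <;> simp [hi] at this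

/-- The convex cone generated by two vectors. -/
def pairCone (u v : E4) : Set E4 := {x | ∃ s t : ℝ, 0 ≤ s ∧ 0 ≤ t ∧ x = s • u + t • v}

lemma left_mem_pairCone (u v : E4) : u ∈ pairCone u v := ⟨1, 0, by simp⟩
lemma right_mem_pairCone (u v : E4) : v ∈ pairCone u v := ⟨0, 1, by simp⟩

lemma mem_pairCone_of_contact {u v y : E4} (hy : y ∈ dualCone K)
    (htop : ∀ p q : ℝ, p ^ 2 + q ^ 2 = 1 → inner ℝ (topPt p q) y = 0 → topPt p q ∈ pairCone u v)
    (hbot : ∀ p q : ℝ, p ^ 2 + q ^ 2 = 1 → inner ℝ (botPt p q) y = 0 → botPt p q ∈ pairCone u v)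
    (hγ : ∀ t ∈ Set.Ioo 0 Real.pi, inner ℝ (lift (γ t)) y = 0 → lift (γ t) ∈ pairCone u v)
    {x : E4} (hx : x ∈ K) (hxy : inner ℝ x y = 0) : x ∈ pairCone u v := by
  refine mem_of_inner_eq_zero (Q := pairCone u v) hy ?_ ?_ ⟨0, 0, by simp⟩ htop hbot hγ hx hxy
  · rintro _ ⟨s, t, hs, ht, rfl⟩ _ ⟨s', t', hs', ht', rfl⟩
    exact ⟨s + s', t + t', add_nonneg hs hs', add_nonneg ht ht', by module⟩
  · rintro l hl _ ⟨s, t, hs, ht, rfl⟩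
    exact ⟨l * s, l * t, mul_nonneg hl hs, mul_nonneg hl ht, by module⟩

namespace IsFace

variable {F : Set E4}

/-- A face inside the cone over the top disc either meets the relative interior of that cone, and then
contains all of it, or it is at most a ray. -/
lemma exists_dual_of_top (hF : IsFace F K) (htop : ∀ x ∈ F, x 2 = x 3) {z : E4}
    (hz : z ∈ dualCone F) : ∃ w ∈ dualCone K, ∀ x ∈ F, inner ℝ x w = inner ℝ x z := by
  have hL : ∀ x ∈ F, 0 ≤ x 3 ∧ x 0 ^ 2 + x 1 ^ 2 ≤ x 3 ^ 2 := fun x hx =>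
    mem_lorentz_of_top (hF.extreme.subset hx) (htop x hx)
  by_cases hint : ∃ x ∈ F, x 0 ^ 2 + x 1 ^ 2 < x 3 ^ 2
  · obtain ⟨x, hx, hxlt⟩ := hint
    have hx3 : 0 < x 3 := lt_of_le_of_ne (hL x hx).1 fun h => by
      rw [← h] at hxlt
      nlinarith [sq_nonneg (x 0), sq_nonneg (x 1)]
    have hcirc : ∀ p q : ℝ, p ^ 2 + q ^ 2 = 1 → topPt p q ∈ F := by
      intro p q hpq
      obtain ⟨r, s, hrs, hr, hs⟩ : ∃ r s : ℝ, r ^ 2 + s ^ 2 < 1 ∧ x 0 = x 3 * r ∧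
          x 1 = x 3 * s := by
        refine ⟨x 0 / x 3, x 1 / x 3, ?_, by field_simp, by field_simp⟩
        rw [div_pow, div_pow, ← add_div, div_lt_one (by positivity)]
        exact hxlt
      -- The line from `(p, q)` through `(r, s)` leaves the disc at `(p, q) + μ * (r - p, s - q)`.
      have hd : 0 < (r - p) ^ 2 + (s - q) ^ 2 := by
        nlinarith [sq_nonneg (r * q - s * p), sq_nonneg (r * p + s * q - 1)]
      obtain ⟨μ, hμ1, hμ⟩ : ∃ μ : ℝ, 1 < μ ∧
          μ * ((r - p) ^ 2 + (s - q) ^ 2) = 2 * (1 - (p * r + q * s)) := by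
        refine ⟨2 * (1 - (p * r + q * s)) / ((r - p) ^ 2 + (s - q) ^ 2), ?_, by field_simp⟩
        rw [one_lt_div hd]
        nlinarith
      have hμ0 : 0 < μ := by linarith
      have hq' : (p + μ * (r - p)) ^ 2 + (q + μ * (s - q)) ^ 2 = 1 := by
        linear_combination hpq * (1 - 2 * μ) + μ * hμ
      have hsum : (x 3 * (1 - 1 / μ)) • topPt p q +
          (x 3 / μ) • topPt (p + μ * (r - p)) (q + μ * (s - q)) = x := by
        apply ext_four
        · simp [hr]
          field_simp
          ring
        · simp [hs]
          field_simp
          ring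
        · simp [htop x hx]
          field_simp
          ring
        · simp
          field_simp
          ring
      have h1 : 0 < x 3 * (1 - 1 / μ) := by
        have : 1 / μ < 1 := (div_lt_one hμ0).2 hμ1
        exact mul_pos hx3 (by linarith)
      refine hF.mem_of_smul_mem h1 (hF.mem_of_add_mem (smul_mem_K h1.le (topPt_mem_K hpq))
        (smul_mem_K (div_pos hx3 hμ0).le (topPt_mem_K hq')) ?_)
      rw [hsum]
      exact hx
    have hzc : ∀ p q : ℝ, p ^ 2 + q ^ 2 = 1 → 0 ≤ z 0 * p + z 1 * q + (z 2 + z 3) := by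
      intro p q hpq
      have := hz _ (hcirc p q hpq)
      rw [inner_topPt] at this
      linarith
    obtain ⟨M, hM⟩ := exists_height_multiple hzc
    refine ⟨z + (|M| + 2 * |z 2|) • !₂[0, 0, -1, 1], mem_dualCone_K ?_ ?_ ?_, ?_⟩
    · intro p q hpq
      rw [inner_topPt]
      simp
      linarith [hzc p q hpq]
    · intro p q hpq
      rw [inner_botPt]
      simp
      linarith [hzc p q hpq, le_abs_self (z 2), abs_nonneg M, abs_nonneg (z 2)]
    · intro t _
      rw [inner_γ]
      have h1 := hM t
      have h2 := mul_le_mul_of_nonneg_right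
        (show M ≤ |M| + 2 * |z 2| - z 2 by
          linarith [le_abs_self M, le_abs_self (z 2), abs_nonneg (z 2)]) (height_nonneg t)
      simp
      linarith
    · intro x hx
      rw [inner_add_right, real_inner_smul_right, inner_four x !₂[0, 0, -1, 1]]
      simp [htop x hx]
  · push Not at hint
    have heq : ∀ x ∈ F, x 0 ^ 2 + x 1 ^ 2 = x 3 ^ 2 := fun x hx =>
      le_antisymm (hL x hx).2 (hint x hx)
    by_cases hne : ∃ p ∈ F, p 3 ≠ 0
    · obtain ⟨p, hp, hp0⟩ := hne
      have hp3 : 0 < p 3 := lt_of_le_of_ne (hL p hp).1 (Ne.symm hp0)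
      refine exists_dual_of_ray hp3 hp (fun x hx => ⟨x 3 / p 3, ?_⟩) hz
      -- Equality in the Cauchy-Schwarz inequality, as `x + p` lies on the boundary of the disc cone.
      have hx' := heq x hx
      have hp' := heq p hp
      have h := heq _ (hF.add_mem hx hp)
      simp only [PiLp.add_apply] at h
      have hxp : x 0 * p 0 + x 1 * p 1 = x 3 * p 3 := by linarith
      have hs : (x 0 * p 3 - x 3 * p 0) ^ 2 + (x 1 * p 3 - x 3 * p 1) ^ 2 = 0 := by
        linear_combination p 3 ^ 2 * hx' + x 3 ^ 2 * hp' - 2 * x 3 * p 3 * hxp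
      have h0 : x 0 * p 3 = x 3 * p 0 := by
        nlinarith [sq_nonneg (x 0 * p 3 - x 3 * p 0), sq_nonneg (x 1 * p 3 - x 3 * p 1)]
      have h1 : x 1 * p 3 = x 3 * p 1 := by
        nlinarith [sq_nonneg (x 0 * p 3 - x 3 * p 0), sq_nonneg (x 1 * p 3 - x 3 * p 1)]
      apply ext_four
      · simp only [PiLp.smul_apply, smul_eq_mul]
        field_simp
        exact h0
      · simp only [PiLp.smul_apply, smul_eq_mul]
        field_simp
        exact h1
      · simp only [PiLp.smul_apply, smul_eq_mul, htop x hx, htop p hp]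
        field_simp
      · simp only [PiLp.smul_apply, smul_eq_mul]
        field_simp
    · push Not at hne
      refine ⟨0, fun x _ => by simp, fun x hx => ?_⟩
      have h3 := hne x hx
      have h := heq x hx
      rw [h3] at h
      have : x = 0 := by
        apply ext_four
        · simp; nlinarith [sq_nonneg (x 0), sq_nonneg (x 1)]
        · simp; nlinarith [sq_nonneg (x 0), sq_nonneg (x 1)]
        · simp [htop x hx, h3]
        · simp [h3]
      rw [this, inner_zero_left, inner_zero_left]

/-- A face in the cone generated by a point of the top circle and a point of `γ`: the first is
exposed from the second by the top plane, the second from the first by a vertical tangent plane. -/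
lemma exists_dual_of_top_γ (hF : IsFace F K) {p q t : ℝ} (hpq : p ^ 2 + q ^ 2 = 1)
    (ht : t ∈ Set.Ioo 0 Real.pi) (hpair : ∀ x ∈ F, x ∈ pairCone (topPt p q) (lift (γ t))) {z : E4}
    (hz : z ∈ dualCone F) : ∃ w ∈ dualCone K, ∀ x ∈ F, inner ℝ x w = inner ℝ x z := by
  refine hF.exists_dual_of_pair (topPt_mem_K hpq) (γ_mem_K ⟨ht.1.le, ht.2.le⟩)
    (tangent_mem_dualCone (Real.cos_sq_add_sin_sq (2 * t))) top_mem_dualCone ?_ ?_ ?_ ?_ hpair hz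
  · rw [inner_topPt]
    simp
    nlinarith [cos_two_mul_lt_one ht, sq_nonneg (Real.cos (2 * t) - p),
      sq_nonneg (Real.sin (2 * t) - q), Real.cos_sq_add_sin_sq (2 * t)]
  · rw [inner_topPt]
    simp
  · rw [inner_γ]
    simp
    linear_combination -2 * Real.cos_sq_add_sin_sq (2 * t)
  · rw [inner_γ]
    have := height_pos ht
    simpa using this

/-- A face inside the cone over the vertical segment joining the two circles. -/
lemma exists_dual_of_top_bot (hF : IsFace F K)
    (hpair : ∀ x ∈ F, x ∈ pairCone (topPt 1 0) (botPt 1 0)) {z : E4}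
    (hz : z ∈ dualCone F) : ∃ w ∈ dualCone K, ∀ x ∈ F, inner ℝ x w = inner ℝ x z := by
  refine hF.exists_dual_of_pair (topPt_mem_K (by norm_num)) (botPt_mem_K (by norm_num))
    bot_mem_dualCone top_mem_dualCone ?_ ?_ ?_ ?_ hpair hz
  · rw [inner_topPt]; simp
  · rw [inner_topPt]; simp
  · rw [inner_botPt]; simp
  · rw [inner_botPt]; simp

/-- A supporting plane which is not horizontal and does not face downwards touches the generators in
at most one point of the top circle and one point of `γ`, or in `(1, 0, 1)` and `(1, 0, -1)`. -/
lemma exists_dual_of_tilted (hF : IsFace F K) {y z : E4} (hy : y ∈ dualCone K) (hy2 : y 2 ≤ 0)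
    (hn : 0 < y 0 ^ 2 + y 1 ^ 2) (hperp : ∀ x ∈ F, inner ℝ x y = 0)
    (hz : z ∈ dualCone F) : ∃ w ∈ dualCone K, ∀ x ∈ F, inner ℝ x w = inner ℝ x z := by
  have hcirc : ∀ p q : ℝ, p ^ 2 + q ^ 2 = 1 → 0 ≤ y 0 * p + y 1 * q + (y 3 + y 2) := by
    intro p q hpq
    have := hy _ (topPt_mem_K hpq)
    rw [inner_topPt] at this
    linarith
  obtain ⟨he, hne⟩ := sq_add_sq_le_of_forall_circle hcirc
  have he' : 0 < y 3 + y 2 := lt_of_le_of_ne he fun h => by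
    rw [← h] at hne
    linarith
  have htopc : ∀ p q : ℝ, p ^ 2 + q ^ 2 = 1 → inner ℝ (topPt p q) y = 0 →
      y 0 = -(y 3 + y 2) * p ∧ y 1 = -(y 3 + y 2) * q := by
    intro p q hpq h
    rw [inner_topPt] at h
    exact circle_contact hne hpq (by linarith)
  have htopu : ∀ p q p' q' : ℝ, p ^ 2 + q ^ 2 = 1 → p' ^ 2 + q' ^ 2 = 1 →
      inner ℝ (topPt p q) y = 0 → inner ℝ (topPt p' q') y = 0 → p = p' ∧ q = q' := by
    intro p q p' q' hpq hpq' h h'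
    obtain ⟨h0, h1⟩ := htopc p q hpq h
    obtain ⟨h0', h1'⟩ := htopc p' q' hpq' h'
    have hne0 : -(y 3 + y 2) ≠ 0 := by linarith
    exact ⟨mul_left_cancel₀ hne0 (h0.symm.trans h0'), mul_left_cancel₀ hne0 (h1.symm.trans h1')⟩
  by_cases hbot : ∃ p q : ℝ, p ^ 2 + q ^ 2 = 1 ∧ inner ℝ (botPt p q) y = 0
  · -- Contact with both circles: `y` is vertical, and the big disc forces the contact at `(1, 0)`.
    obtain ⟨p, q, hpq, hb⟩ := hbot
    rw [inner_botPt] at hb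
    have hy20 : y 2 = 0 := by linarith [hcirc p q hpq]
    obtain ⟨h0, h1⟩ := htopc p q hpq (by rw [inner_topPt]; linarith)
    have hp : p = 1 := by
      obtain ⟨s, hs, rfl, rfl⟩ := exists_angle hpq
      have h := hy _ (γ_mem_K (t := s / 2) ⟨by linarith [hs.1], by linarith [hs.2]⟩)
      rw [inner_γ, mul_div_cancel₀ s two_ne_zero, h0, h1] at h
      refine le_antisymm (Real.cos_le_one s) ?_
      rw [hy20] at h he'
      nlinarith [Real.cos_sq_add_sin_sq s]
    have hq : q = 0 := by
      rw [hp] at hpq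
      nlinarith [sq_nonneg q]
    subst hp hq
    refine hF.exists_dual_of_top_bot (fun x hx => mem_pairCone_of_contact hy ?_ ?_ ?_
      (hF.extreme.subset hx) (hperp x hx)) hz
    · intro p q hpq h
      obtain ⟨rfl, rfl⟩ := htopu 1 0 p q (by norm_num) hpq (by rw [inner_topPt]; linarith) h
      exact left_mem_pairCone _ _
    · intro p q hpq h
      rw [inner_botPt] at h
      obtain ⟨rfl, rfl⟩ := htopu 1 0 p q (by norm_num) hpq (by rw [inner_topPt]; linarith)
        (by rw [inner_topPt]; linarith)
      exact right_mem_pairCone _ _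
    · intro t ht h
      rw [inner_γ, h0, h1, hy20] at h
      rw [hy20] at he'
      nlinarith [cos_two_mul_lt_one ht]
  · -- Where there is no contact, any point of the curve serves as a generator of the pair.
    obtain ⟨p, q, hpq, htop⟩ : ∃ p q : ℝ, p ^ 2 + q ^ 2 = 1 ∧ ∀ p' q' : ℝ, p' ^ 2 + q' ^ 2 = 1 →
        inner ℝ (topPt p' q') y = 0 → p = p' ∧ q = q' := by
      by_cases h : ∃ p q : ℝ, p ^ 2 + q ^ 2 = 1 ∧ inner ℝ (topPt p q) y = 0
      · obtain ⟨p, q, hpq, h⟩ := h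
        exact ⟨p, q, hpq, fun p' q' hpq' h' => htopu p q p' q' hpq hpq' h h'⟩
      · exact ⟨1, 0, by norm_num, fun p' q' hpq' h' => absurd ⟨p', q', hpq', h'⟩ h⟩
    obtain ⟨t, ht, hγ⟩ : ∃ t ∈ Set.Ioo 0 Real.pi, ∀ s ∈ Set.Ioo 0 Real.pi,
        inner ℝ (lift (γ s)) y = 0 → t = s := by
      by_cases h : ∃ t ∈ Set.Ioo 0 Real.pi, inner ℝ (lift (γ t)) y = 0
      · obtain ⟨t, ht, h⟩ := h
        exact ⟨t, ht, fun s hs h' => γ_contact_unique hy hn hy2 he hne ht hs h h'⟩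
      · exact ⟨Real.pi / 2, ⟨by positivity, by linarith [Real.pi_pos]⟩,
          fun s hs h' => absurd ⟨s, hs, h'⟩ h⟩
    refine hF.exists_dual_of_top_γ hpq ht (fun x hx => mem_pairCone_of_contact hy ?_ ?_ ?_
      (hF.extreme.subset hx) (hperp x hx)) hz
    · intro p' q' hpq' h
      obtain ⟨rfl, rfl⟩ := htop p' q' hpq' h
      exact left_mem_pairCone _ _
    · exact fun p' q' hpq' h => absurd ⟨p', q', hpq', h⟩ hbot
    · intro s hs h
      rw [← hγ s hs h]
      exact right_mem_pairCone _ _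

lemma exists_dual_of_nonpos (hF : IsFace F K) {y z : E4} (hy : y ∈ dualCone K) (hy0 : y ≠ 0)
    (hy2 : y 2 ≤ 0) (hperp : ∀ x ∈ F, inner ℝ x y = 0)
    (hz : z ∈ dualCone F) : ∃ w ∈ dualCone K, ∀ x ∈ F, inner ℝ x w = inner ℝ x z := by
  rcases (by positivity : 0 ≤ y 0 ^ 2 + y 1 ^ 2).eq_or_lt with hn | hn
  · have h0 : y 0 = 0 := by nlinarith [sq_nonneg (y 0), sq_nonneg (y 1)]
    have h1 : y 1 = 0 := by nlinarith [sq_nonneg (y 0), sq_nonneg (y 1)]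
    have he := hy _ (topPt_mem_K (p := 1) (q := 0) (by norm_num))
    rw [inner_topPt, h0, h1] at he
    rcases hy2.eq_or_lt with h2 | h2
    · -- `y` is a positive multiple of the height functional, and `F = {0}`.
      have h3 : 0 < y 3 := lt_of_le_of_ne (by linarith) fun h => hy0 <| by
        apply ext_four <;> simp [h0, h1, h2, ← h]
      refine hF.exists_dual_of_top (fun x hx => ?_) hz
      have h := hperp x hx
      rw [inner_four, h0, h1, h2] at h
      have hx3 : x 3 = 0 := by
        have : x 3 * y 3 = 0 := by linarith
        exact (mul_eq_zero.1 this).resolve_right h3.ne'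
      have ht := top_mem_dualCone x (hF.extreme.subset hx)
      have hb := bot_mem_dualCone x (hF.extreme.subset hx)
      rw [inner_four] at ht hb
      simp [hx3] at ht hb
      linarith
    · refine hF.exists_dual_of_top (fun x hx => ?_) hz
      have h := hperp x hx
      rw [inner_four, h0, h1] at h
      have ht := top_mem_dualCone x (hF.extreme.subset hx)
      have hv := vertex_mem_dualCone x (hF.extreme.subset hx)
      rw [inner_four] at ht hv
      simp at ht hv
      nlinarith
  · exact hF.exists_dual_of_tilted hy hy2 hn hperp hz

end IsFace

/-! ### Niceness -/

/-- The half-turn `(x, y, z) ↦ (x, -y, -z)` of the base, which preserves `K` and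
exchanges the two discs. -/
def reflect : E4 →ₗ[ℝ] E4 where
  toFun x := !₂[x 0, -x 1, -x 2, x 3]
  map_add' x y := by apply ext_four <;> simp <;> ring
  map_smul' l x := by apply ext_four <;> simp

@[simp] lemma reflect_zero (x : E4) : reflect x 0 = x 0 := rfl
@[simp] lemma reflect_one (x : E4) : reflect x 1 = -x 1 := rfl
@[simp] lemma reflect_two (x : E4) : reflect x 2 = -x 2 := rfl
@[simp] lemma reflect_three (x : E4) : reflect x 3 = x 3 := rfl

lemma reflect_reflect (x : E4) : reflect (reflect x) = x := by
  apply ext_four <;> simp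

lemma inner_reflect (x y : E4) : inner ℝ (reflect x) y = inner ℝ x (reflect y) := by
  simp [inner_four]

lemma reflect_γ (t : ℝ) : reflect (lift (γ t)) = lift (γ (Real.pi - t)) := by
  have h : 2 * (Real.pi - t) = 2 * Real.pi - 2 * t := by ring
  apply ext_four
  · simp [γ_zero, h, Real.cos_two_pi_sub]
  · simp [γ_one, h, Real.sin_two_pi_sub]
  · simp [γ_two]
    ring
  · simp

lemma reflect_mem_K {x : E4} (hx : x ∈ K) : reflect x ∈ K := by
  refine K_subset (Q := {x | reflect x ∈ K}) ?_ ?_ ?_ ?_ ?_ hx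
  · intro x hx y hy
    change reflect (x + y) ∈ K
    rw [map_add]
    exact add_mem_K hx hy
  · intro l hl x hx
    change reflect (l • x) ∈ K
    rw [map_smul]
    exact smul_mem_K hl hx
  · intro p q h
    have : reflect (topPt p q) = botPt p (-q) := by apply ext_four <;> simp
    change reflect _ ∈ K
    rw [this]
    exact botPt_mem_K (by rwa [neg_sq])
  · intro p q h
    have : reflect (botPt p q) = topPt p (-q) := by apply ext_four <;> simp
    change reflect _ ∈ K
    rw [this]
    exact topPt_mem_K (by rwa [neg_sq])
  · intro t ht
    change reflect _ ∈ K
    rw [reflect_γ]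
    exact γ_mem_K ⟨by linarith [ht.2], by linarith [ht.1]⟩

lemma reflect_mem_dualCone {y : E4} (hy : y ∈ dualCone K) : reflect y ∈ dualCone K := fun x hx => by
  rw [← inner_reflect]
  exact hy _ (reflect_mem_K hx)

namespace IsFace

variable {F : Set E4}

lemma preimage_reflect (hF : IsFace F K) : IsFace (reflect ⁻¹' F) K where
  nonempty := by
    obtain ⟨x, hx⟩ := hF.nonempty
    exact ⟨reflect x, by rwa [Set.mem_preimage, reflect_reflect]⟩
  isClosed := hF.isClosed.preimage reflect.continuous_of_finiteDimensional
  convex := hF.convex.linear_preimage reflect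
  extreme := by
    refine ⟨fun x hx => ?_, fun x hx y hy z hz hzxy => ?_⟩
    · rw [← reflect_reflect x]
      exact reflect_mem_K (hF.extreme.subset hx)
    · refine hF.extreme.left_mem_of_mem_openSegment (reflect_mem_K hx) (reflect_mem_K hy) hz ?_
      obtain ⟨a, b, ha, hb, hab, rfl⟩ := hzxy
      exact ⟨a, b, ha, hb, hab, by simp⟩

/-- Every functional nonnegative on a face `F` agrees on `F` with one nonnegative on `K`: this is
niceness of `K` at `F`. -/
lemma exists_dual (hF : IsFace F K) {z : E4} (hz : z ∈ dualCone F) :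
    ∃ w ∈ dualCone K, ∀ x ∈ F, inner ℝ x w = inner ℝ x z := by
  by_cases hne : F = K
  · exact ⟨z, hne ▸ hz, fun _ _ => rfl⟩
  obtain ⟨y, hy, hy0, hperp⟩ := hF.exists_perp hne
  rcases le_total (y 2) 0 with h | h
  · exact hF.exists_dual_of_nonpos hy hy0 h hperp hz
  · obtain ⟨w, hw, hwz⟩ := hF.preimage_reflect.exists_dual_of_nonpos (y := reflect y) (z := reflect z)
      (reflect_mem_dualCone hy) (fun h0 => hy0 (by rw [← reflect_reflect y, h0, map_zero])) (by simpa using h)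
      (fun x hx => by rw [← inner_reflect]; exact hperp _ hx)
      (fun x hx => by rw [← inner_reflect]; exact hz _ hx)
    refine ⟨reflect w, reflect_mem_dualCone hw, fun x hx => ?_⟩
    rw [← inner_reflect, hwz _ (by rwa [Set.mem_preimage, reflect_reflect]), ← inner_reflect, reflect_reflect]

end IsFace

lemma isNice_K : IsNice K := by
  intro F hF
  refine Set.Subset.antisymm (fun z hz => ?_) ?_
  · obtain ⟨w, hw, hwz⟩ := hF.exists_dual hz
    refine ⟨w, hw, z - w, fun x hx => ?_, add_sub_cancel w z⟩
    rw [inner_sub_right, hwz x hx, sub_self]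
  · rintro _ ⟨w, hw, v, hv, rfl⟩ x hx
    rw [inner_add_right, hv x hx, add_zero]
    exact hw x (hF.extreme.subset hx)

/-! ### Failure of amenability -/

lemma isFace_top : IsFace {x ∈ K | x 2 = x 3} K where
  nonempty := ⟨0, zero_mem_K, rfl⟩
  isClosed := isClosed_K.inter (isClosed_eq (by fun_prop) (by fun_prop))
  convex := fun x hx y hy a b ha hb hab =>
    ⟨convex_K hx.1 hy.1 ha hb hab, by simp [hx.2, hy.2]⟩
  extreme := by
    refine ⟨fun x hx => hx.1, ?_⟩
    rintro x hx y hy z ⟨-, hz⟩ ⟨a, b, ha, hb, -, rfl⟩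
    refine ⟨hx, ?_⟩
    have h1 := top_mem_dualCone x hx
    have h2 := top_mem_dualCone y hy
    rw [inner_four] at h1 h2
    simp at h1 h2 hz
    nlinarith

/-- The triangle inequality in the plane, in squared form. -/
lemma sq_add_sq_le_of_close {r a b p q ρ : ℝ} (hρ : 0 ≤ ρ) (hr : 0 ≤ r)
    (hpq : p ^ 2 + q ^ 2 ≤ r ^ 2) (hd : (a - p) ^ 2 + (b - q) ^ 2 ≤ ρ ^ 2) :
    a ^ 2 + b ^ 2 ≤ (r + ρ) ^ 2 := by
  have h : (a - p) * p + (b - q) * q ≤ ρ * r := by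
    refine le_of_sq_le_sq ?_ (mul_nonneg hρ hr)
    nlinarith [sq_nonneg ((a - p) * q - (b - q) * p),
      mul_le_mul hd hpq (by positivity) (by positivity)]
  nlinarith

/-- Amenability fails at the cone over the top disc. Near `t = 0` the point of `γ` pushed up to height
`1` has distance of order `t ^ 2` to the disc, but only of order `t ^ 4` to `K`. -/
lemma not_isAmenable_K : ¬ IsAmenable K := by
  intro hA
  obtain ⟨κ, hκ, h⟩ := hA _ isFace_top
  set F : Set E4 := {x ∈ K | x 2 = x 3}
  -- The point of `γ` with `1 - cos t = τ`, for a small `τ`.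
  obtain ⟨τ, hτ0, hτ1, hτκ⟩ : ∃ τ : ℝ, 0 < τ ∧ τ ≤ 1 ∧ κ * τ ≤ 1 / 3 := by
    refine ⟨1 / (3 * κ + 1), by positivity, ?_, ?_⟩
    · rw [div_le_one (by positivity)]
      linarith
    · rw [mul_one_div, div_le_div_iff₀ (by positivity) (by norm_num)]
      linarith
  set t := Real.arccos (1 - τ)
  have hcos : Real.cos t = 1 - τ := Real.cos_arccos (by linarith) (by linarith)
  set x : E4 := topPt (2 * Real.cos (2 * t) - 1) (2 * Real.sin (2 * t)) with hx
  have htopF : ∀ p q : ℝ, p ^ 2 + q ^ 2 = 1 → topPt p q ∈ F := fun p q hpq =>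
    ⟨topPt_mem_K hpq, rfl⟩
  have hspan : ∀ p q : ℝ, topPt p q ∈ Submodule.span ℝ F := by
    intro p q
    have : topPt p q = ((1 - q + p) / 2) • topPt 1 0 + ((1 - q - p) / 2) • topPt (-1) 0 +
        q • topPt 0 1 := by
      apply ext_four <;> simp <;> ring
    rw [this]
    have t1 := Submodule.subset_span (R := ℝ) (htopF 1 0 (by norm_num))
    have t2 := Submodule.subset_span (R := ℝ) (htopF (-1) 0 (by norm_num))
    have t3 := Submodule.subset_span (R := ℝ) (htopF 0 1 (by norm_num))
    exact add_mem (add_mem (Submodule.smul_mem _ _ t1) (Submodule.smul_mem _ _ t2))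
      (Submodule.smul_mem _ _ t3)
  have hK : Metric.infDist x K ≤ 3 / 2 * τ ^ 2 := by
    refine (Metric.infDist_le_dist_of_mem
      (γ_mem_K (t := t) ⟨Real.arccos_nonneg _, Real.arccos_le_pi _⟩)).trans ?_
    refine le_of_sq_le_sq ?_ (by positivity)
    rw [EuclideanSpace.dist_sq_eq, Fin.sum_univ_four]
    simp only [Real.dist_eq, hx, γ_zero, γ_one, γ_two, hcos, topPt_zero, topPt_one, topPt_two,
      topPt_three, lift_zero, lift_one, lift_two, lift_three, sq_abs]
    have h1 : τ ^ 2 * (3 - τ) ≤ 3 * τ ^ 2 := by nlinarith [pow_pos hτ0 3]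
    have h2 : 0 ≤ τ ^ 2 * (3 - τ) := mul_nonneg (sq_nonneg τ) (by linarith)
    nlinarith
  have hF : 2 * τ ≤ Metric.infDist x F + Metric.infDist x F ^ 2 := by
    obtain ⟨y, hy, hxy⟩ := isFace_top.isClosed.exists_infDist_eq_dist isFace_top.nonempty x
    rw [hxy]
    have hd : dist x y ^ 2 = (x 0 - y 0) ^ 2 + (x 1 - y 1) ^ 2 + (x 2 - y 2) ^ 2 +
        (x 3 - y 3) ^ 2 := by
      rw [EuclideanSpace.dist_sq_eq, Fin.sum_univ_four]
      simp [Real.dist_eq]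
    set ρ := dist x y
    have hρ0 : 0 ≤ ρ := dist_nonneg
    obtain ⟨hy3, hyL⟩ := mem_lorentz_of_top hy.1 hy.2
    have hle := sq_add_sq_le_of_close (a := x 0) (b := x 1) hρ0 hy3 hyL
      (by nlinarith [sq_nonneg (x 2 - y 2), sq_nonneg (x 3 - y 3)])
    have hy3' : y 3 ≤ 1 + ρ := by
      have : |y 3 - x 3| ≤ ρ := by
        refine abs_le_of_sq_le_sq ?_ hρ0
        nlinarith [sq_nonneg (x 2 - y 2), sq_nonneg (x 0 - y 0), sq_nonneg (x 1 - y 1)]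
      have hx3 : x 3 = 1 := rfl
      linarith [(abs_le.1 this).2]
    have hle' : x 0 ^ 2 + x 1 ^ 2 ≤ (1 + 2 * ρ) ^ 2 :=
      hle.trans (pow_le_pow_left₀ (add_nonneg hy3 hρ0) (by linarith) 2)
    have hx01 : x 0 ^ 2 + x 1 ^ 2 = 5 - 4 * Real.cos (2 * t) := by
      simp only [hx, topPt_zero, topPt_one]
      linear_combination 4 * Real.cos_sq_add_sin_sq (2 * t)
    rw [hx01, Real.cos_two_mul, hcos] at hle'
    nlinarith
  have hδ := h x (hspan _ _)
  have hδ' : Metric.infDist x F ≤ κ * (3 / 2 * τ ^ 2) :=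
    hδ.trans (mul_le_mul_of_nonneg_left hK hκ.le)
  have hδ'' : Metric.infDist x F ≤ τ / 2 := by nlinarith
  nlinarith [Metric.infDist_nonneg (x := x) (s := F)]

end NiceCone

end

theorem mainTheorem2 :
    (IsClosed NiceCone.K ∧ Convex ℝ NiceCone.K ∧ Submodule.span ℝ NiceCone.K = ⊤ ∧
      NiceCone.IsNice NiceCone.K ∧ ¬ NiceCone.IsAmenable NiceCone.K) ∧
    ∃ K : ProperCone ℝ (EuclideanSpace ℝ (Fin 4)),
      NiceCone.IsNice (K : Set (EuclideanSpace ℝ (Fin 4))) ∧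
        ¬ NiceCone.IsAmenable (K : Set (EuclideanSpace ℝ (Fin 4))) := by
  refine ⟨⟨NiceCone.isClosed_K, NiceCone.convex_K, NiceCone.span_K, NiceCone.isNice_K,
    NiceCone.not_isAmenable_K⟩, ?_⟩
  exact ⟨{ carrier := NiceCone.K
           add_mem' := NiceCone.add_mem_K
           zero_mem' := NiceCone.zero_mem_K
           smul_mem' := fun l _ hx => NiceCone.smul_mem_K l.2 hx
           isClosed' := NiceCone.isClosed_K }, NiceCone.isNice_K, NiceCone.not_isAmenable_K⟩
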